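/- **Theorem 3.1.** Let $g>0$, $\omega\in\mathbb R$, $l,m>0$, $\Omega_+=\mathbb R^2\times(0,l)$, $\Omega_-=\mathbb R^2\times(-m,0)$, and $\Omega=\mathbb R^2\times(-m,l)$. Let $p_\pm\in C^\infty(0,\infty)$ be nonnegative and strictly increasing pressure laws with $1/p_\pm'\in L^\infty_{\rm loc}(0,\infty)$. Let $\rho_0=\rho_0(x_3)$ be bounded above and below by positive constants on $(-m,l)$, smooth on $(-m,0)$ and on $(0,l)$, with $$\frac{d\,p_+(\rho_0)}{dx_3}=-g\rho_0 \text{ on }(0,l),\qquad \frac{d\,p_-(\rho_0)}{dx_3}=-g\rho_0\text{ on }(-m,0),$$ and with one-sided limits $\rho_0^\pm$ at $x_3=0$ satisfying $p_+(\rho_0^+)=p_-(\rho_0^-)$ and $\rho_0^+-\rho_0^->0$. Write $p'(\rho_0)$ for $p_\pm'(\rho_0)$ in $\Omega_\pm$, let $H^1(\Omega)$ be the space of functions $f$ with $f|_{\Omega_\pm}\in H^1(\Omega_\pm)$, and let $\llbracket f\rrbracket$ be the trace of $f|_{\Omega_+}$ minus the trace of $f|_{\Omega_-}$ on $\{x_3=0\}$.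 For $0<T\le\infty$, a solution on $[0,T)$ is a triple $(\eta,v,q)$, with $\eta,v$ valued in $\mathbb R^3$ and $q$ in $\mathbb R$, such that $\eta,v,q\in C([0,T);L^2(\Omega))$ and, for every $0<t<T$, $\eta(t),v(t),q(t)\in H^1(\Omega)$, the time derivatives $\partial_t\eta,\partial_tv,\partial_tq$ exist at $t$ in $L^2(\Omega)$, $$\partial_t\eta=v,\qquad \partial_tq+\rho_0\,{\rm div}\,v=0,$$ $$\rho_0\partial_tv+\nabla(p'(\rho_0)q)=-gqe_3-g\rho_0\nabla\eta_3+2\rho_0\omega v_2e_1-2\rho_0\omega v_1e_2$$ hold almost everywhere in $\Omega_+\cup\Omega_-$, and, in the sense of traces, $$\llbracket v\cdot e_3\rrbracket=0,\quad \llbracket p'(\rho_0)q\rrbracket=0,\quad v_-(t,x',-m)\cdot e_3=v_+(t,x',l)\cdot e_3=0.$$ If $(\eta_1,v_1,q_1)$ and $(\eta_2,v_2,q_2)$ are two solutions on $[0,T)$ with the same initial data, $(\eta_1,v_1,q_1)(0)=(\eta_2,v_2,q_2)(0)$ almost everywhere in $\Omega$, then for every $t\in[0,T)$ one has $\eta_1(t)=\eta_2(t)$,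 $v_1(t)=v_2(t)$ and $q_1(t)=q_2(t)$ almost everywhere in $\Omega$. -/

import Mathlib

open MeasureTheory Filter Topology Set
open scoped ContDiff ENNReal

noncomputable section

namespace RotatingRT

/-- Horizontal points `x' = (x₁, x₂)`. -/
abbrev Hor : Type := EuclideanSpace ℝ (Fin 2)

/-- Points `x = (x', x₃)` of `ℝ² × ℝ`; `volume` on this type is three-dimensional Lebesgue
measure. -/
abbrev Pt : Type := Hor × ℝ

/-- The coordinate vectors `e₁, e₂, e₃` (indexed by `0, 1, 2`). -/
def e : Fin 3 → Pt :=
  ![(EuclideanSpace.single 0 1, 0), (EuclideanSpace.single 1 1, 0), (0, 1)]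

/-! ### Sobolev functions, time derivatives in `L²`, traces -/

/-- On the open set `U`, both `f` and `g` are in `L²(U)` and `g` is the weak partial derivative
`∂ᵢ f`. -/
structure HasWeakPartial (U : Set Pt) (i : Fin 3) (f g : Pt → ℝ) : Prop where
  memLp_fun : MemLp f 2 (volume.restrict U)
  memLp_deriv : MemLp g 2 (volume.restrict U)
  integral_eq : ∀ φ : Pt → ℝ, ContDiff ℝ ∞ φ → HasCompactSupport φ → tsupport φ ⊆ U →
    ∫ x in U, f x * fderiv ℝ φ x (e i) = - ∫ x in U, g x * φ x

/-- The Sobolev space `H¹(U)`. -/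
def MemH1 (U : Set Pt) (f : Pt → ℝ) : Prop :=
  MemLp f 2 (volume.restrict U) ∧ ∀ i, ∃ g, HasWeakPartial U i f g

/-- `f' ∈ L²(U)` is the derivative at time `t` of the curve `s ↦ f s` in `L²(U)`: the difference
quotients converge to `f'` in the norm of `L²(U)`. -/
def HasL2Deriv (U : Set Pt) (f : ℝ → Pt → ℝ) (f' : Pt → ℝ) (t : ℝ) : Prop :=
  MemLp f' 2 (volume.restrict U) ∧
    Tendsto (fun s => eLpNorm (fun x => (s - t)⁻¹ * (f s x - f t x) - f' x) 2 (volume.restrict U))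
      (𝓝[≠] t) (𝓝 0)

/-- On the set `I` of times, `f` is a continuous curve in `L²(U)`. -/
def L2ContinuousOn (U : Set Pt) (f : ℝ → Pt → ℝ) (I : Set ℝ) : Prop :=
  (∀ t ∈ I, MemLp (f t) 2 (volume.restrict U)) ∧
    ∀ t ∈ I, Tendsto (fun s => eLpNorm (fun x => f s x - f t x) 2 (volume.restrict U))
      (𝓝[I] t) (𝓝 0)

/-- `w ∈ L²(ℝ²)` is the trace of `f` on the plane `{x₃ = c}`, taken from the side described by
`F` (`F = 𝓝[>] c` from above, `F = 𝓝[<] c` from below): the slices `f(·, s)` converge to `w` in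
`L²(ℝ²)` as `s → c` along `F`, a null set of heights `s` being disregarded, so that the notion
only depends on the almost-everywhere class of `f`. -/
def HasTrace (F : Filter ℝ) (f : Pt → ℝ) (w : Hor → ℝ) : Prop :=
  MemLp w 2 volume ∧
    Tendsto (fun s : ℝ => eLpNorm (fun x' : Hor => f (x', s) - w x') 2 volume)
      (F ⊓ ae volume) (𝓝 0)

/-- `⟦f⟧ = 0`: the traces of `f` on `{x₃ = 0}` from above and from below exist and have zero
difference. -/
def NoJump (f : Pt → ℝ) : Prop :=
  ∃ fp fm : Hor → ℝ, HasTrace (𝓝[>] 0) f fp ∧ HasTrace (𝓝[<] 0) f fm ∧ fp - fm =ᵐ[volume] 0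

/-! ### The physical data -/

/-- The data of the problem: gravity `g`, angular velocity `angVel` (written `ω` below), the slab `ℝ² × (-m, l)`, the
pressure laws of the upper and of the lower fluid, and the steady density profile. -/
structure Data where
  g : ℝ
  angVel : ℝ
  l : ℝ
  m : ℝ
  pUp : ℝ → ℝ
  pLow : ℝ → ℝ
  ρ₀ : ℝ → ℝ

/-- A barotropic pressure law: nonnegative, smooth and strictly increasing on `(0, ∞)`, with
`1 / p'` locally bounded on `(0, ∞)`. -/
structure PressureLaw (p : ℝ → ℝ) : Prop where
  nonneg : ∀ z, 0 < z → 0 ≤ p z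
  smooth : ContDiffOn ℝ ∞ p (Ioi 0)
  strictMono : StrictMonoOn p (Ioi 0)
  inv_deriv_bounded : ∀ K : Set ℝ, IsCompact K → K ⊆ Ioi 0 →
    ∃ C : ℝ, ∀ z ∈ K, 1 ≤ C * deriv p z

/-- The standing assumptions: positive gravity, a nondegenerate slab, two pressure laws, and a
steady state `ρ₀` which is bounded above and below by positive constants, smooth on either side
of `{x₃ = 0}`, solves the hydrostatic equation `d p(ρ₀) / dx₃ = - g ρ₀` on both sides, has
continuous pressure across `{x₃ = 0}`, and is denser just above `{x₃ = 0}` than just below. -/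
structure Data.Admissible (D : Data) : Prop where
  g_pos : 0 < D.g
  l_pos : 0 < D.l
  m_pos : 0 < D.m
  pressureUp : PressureLaw D.pUp
  pressureLow : PressureLaw D.pLow
  density_bounds : ∃ a b : ℝ, 0 < a ∧ ∀ z ∈ Ioo (-D.m) D.l, a ≤ D.ρ₀ z ∧ D.ρ₀ z ≤ b
  smooth_up : ContDiffOn ℝ ∞ D.ρ₀ (Ioo 0 D.l)
  smooth_low : ContDiffOn ℝ ∞ D.ρ₀ (Ioo (-D.m) 0)
  steady_up : ∀ z ∈ Ioo 0 D.l, HasDerivAt (fun y => D.pUp (D.ρ₀ y)) (-D.g * D.ρ₀ z) z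
  steady_low : ∀ z ∈ Ioo (-D.m) 0, HasDerivAt (fun y => D.pLow (D.ρ₀ y)) (-D.g * D.ρ₀ z) z
  interface : ∃ rUp rLow : ℝ, Tendsto D.ρ₀ (𝓝[>] 0) (𝓝 rUp) ∧ Tendsto D.ρ₀ (𝓝[<] 0) (𝓝 rLow) ∧
    D.pUp rUp = D.pLow rLow ∧ 0 < rUp - rLow

namespace Data

variable (D : Data)

/-- `Ω₊ = ℝ² × (0, l)`. -/
def upper : Set Pt := {x | 0 < x.2 ∧ x.2 < D.l}

/-- `Ω₋ = ℝ² × (-m, 0)`. -/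
def lower : Set Pt := {x | -D.m < x.2 ∧ x.2 < 0}

/-- `Ω₊ ∪ Ω₋`, the slab without the (Lebesgue-null) interface `{x₃ = 0}`. -/
def domain : Set Pt := D.upper ∪ D.lower

/-- `p'(ρ₀)` as a function of `x₃`: `p₊'(ρ₀)` above the interface, `p₋'(ρ₀)` below it. -/
def dp (z : ℝ) : ℝ := if 0 < z then deriv D.pUp (D.ρ₀ z) else deriv D.pLow (D.ρ₀ z)

/-- The piecewise Sobolev space `H¹(Ω)`: the restrictions of `f` to `Ω₊` and to `Ω₋` are in
`H¹(Ω₊)` and in `H¹(Ω₋)`; nothing is required across the interface. -/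
def PiecewiseH1 (f : Pt → ℝ) : Prop := MemH1 D.upper f ∧ MemH1 D.lower f

/-- `g = ∂ᵢ f` weakly in `Ω₊` and in `Ω₋`. -/
def HasPartial (i : Fin 3) (f g : Pt → ℝ) : Prop :=
  HasWeakPartial D.upper i f g ∧ HasWeakPartial D.lower i f g

/-- `(η, v, q)` solves, on the time interval `[0, T)`, the linearized rotating equations with
their jump and boundary conditions.  The unknowns are continuous in time with values in `L²(Ω)`;
at each time `0 < t < T` they lie in the piecewise space `H¹(Ω)`, have time derivatives in
`L²(Ω)`, and satisfy the equations almost everywhere and the jump and boundary conditions in the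
sense of traces. -/
structure IsSolution (T : EReal) (η v : ℝ → Pt → EuclideanSpace ℝ (Fin 3)) (q : ℝ → Pt → ℝ) :
    Prop where
  continuous_η : ∀ i, L2ContinuousOn D.domain (fun t x => η t x i) {t | 0 ≤ t ∧ (t : EReal) < T}
  continuous_v : ∀ i, L2ContinuousOn D.domain (fun t x => v t x i) {t | 0 ≤ t ∧ (t : EReal) < T}
  continuous_q : L2ContinuousOn D.domain q {t | 0 ≤ t ∧ (t : EReal) < T}
  sobolev_η : ∀ t : ℝ, 0 < t → (t : EReal) < T → ∀ i, D.PiecewiseH1 (fun x => η t x i)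
  sobolev_v : ∀ t : ℝ, 0 < t → (t : EReal) < T → ∀ i, D.PiecewiseH1 (fun x => v t x i)
  sobolev_q : ∀ t : ℝ, 0 < t → (t : EReal) < T → D.PiecewiseH1 (q t)
  /-- `∂ₜ η = v` -/
  flow : ∀ t : ℝ, 0 < t → (t : EReal) < T → ∀ i,
    HasL2Deriv D.domain (fun s x => η s x i) (fun x => v t x i) t
  /-- `∂ₜ q + ρ₀ div v = 0` -/
  mass : ∀ t : ℝ, 0 < t → (t : EReal) < T →
    ∃ (qt : Pt → ℝ) (Dv : Fin 3 → Pt → ℝ),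
      HasL2Deriv D.domain q qt t ∧
      (∀ i, D.HasPartial i (fun x => v t x i) (Dv i)) ∧
      ∀ᵐ x ∂(volume.restrict D.domain), qt x + D.ρ₀ x.2 * ∑ i, Dv i x = 0
  /-- `ρ₀ ∂ₜ v + ∇(p'(ρ₀) q) = - g q e₃ - g ρ₀ ∇η₃ + 2 ρ₀ ω v₂ e₁ - 2 ρ₀ ω v₁ e₂` -/
  momentum : ∀ t : ℝ, 0 < t → (t : EReal) < T →
    ∃ vt Dpq Dη₃ : Fin 3 → Pt → ℝ,
      (∀ i, HasL2Deriv D.domain (fun s x => v s x i) (vt i) t) ∧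
      (∀ i, D.HasPartial i (fun x => D.dp x.2 * q t x) (Dpq i)) ∧
      (∀ i, D.HasPartial i (fun x => η t x 2) (Dη₃ i)) ∧
      ∀ᵐ x ∂(volume.restrict D.domain),
        D.ρ₀ x.2 * vt 0 x + Dpq 0 x =
          -D.g * D.ρ₀ x.2 * Dη₃ 0 x + 2 * D.ρ₀ x.2 * D.angVel * v t x 1 ∧
        D.ρ₀ x.2 * vt 1 x + Dpq 1 x =
          -D.g * D.ρ₀ x.2 * Dη₃ 1 x - 2 * D.ρ₀ x.2 * D.angVel * v t x 0 ∧
        D.ρ₀ x.2 * vt 2 x + Dpq 2 x =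
          -D.g * q t x - D.g * D.ρ₀ x.2 * Dη₃ 2 x
  /-- `⟦v · e₃⟧ = 0` -/
  jump_v : ∀ t : ℝ, 0 < t → (t : EReal) < T → NoJump (fun x => v t x 2)
  /-- `⟦p'(ρ₀) q⟧ = 0` -/
  jump_q : ∀ t : ℝ, 0 < t → (t : EReal) < T → NoJump (fun x => D.dp x.2 * q t x)
  /-- `v₊(t, x', l) · e₃ = 0` -/
  boundary_top : ∀ t : ℝ, 0 < t → (t : EReal) < T →
    HasTrace (𝓝[<] D.l) (fun x => v t x 2) 0
  /-- `v₋(t, x', -m) · e₃ = 0` -/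
  boundary_bottom : ∀ t : ℝ, 0 < t → (t : EReal) < T →
    HasTrace (𝓝[>] (-D.m)) (fun x => v t x 2) 0

end Data

end RotatingRT

end

noncomputable section

namespace RotatingRT

/-! The difference of two solutions solves the same linear system with zero initial data.
Integrating the mass equation in time along `∂ₜη = v` gives `q + ρ₀ div η = 0` (`add_div_eq_zero`).
In the third momentum equation this turns `-g q - g ρ₀ ∂₃η₃` into `g ρ₀ (∂₁η₁ + ∂₂η₂)`. The
right-hand sides then contain horizontal derivatives only, and the coefficients do not depend on the
horizontal variables.

The energy `∫ ρ₀|v|² + (p'(ρ₀)/ρ₀) q² + |η|²` is not closed: its derivative contains horizontal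
first derivatives of `η`. The pressure and divergence terms cancel by integration by parts, where
the vertical part uses the jump and boundary conditions, and the Coriolis terms cancel by
antisymmetry. What remains loses one horizontal derivative, so no Gronwall argument applies
directly.

The loss is absorbed as in a Cauchy–Kovalevskaya argument. The unknowns are averaged horizontally
against the `j`-th and `k`-th derivatives of a Gaussian. These averages commute with the equations,
and a horizontal derivative becomes an increment of `j` or `k`. The energies `y j k` of the averaged
states satisfy `(√y j k)' ≤ K (√y j k + √y (j+1) k + √y j (k+1))`, in the sense made precise in
`hierarchy_eq_zero`. The Gaussian is entire, so Cauchy's estimates bound the `n`-th level by `A n! /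
r ^ n` for every `r`. Iterating `n` times from zero data gains `(2Kt)^n / n!`, and for `r` large
against `Kt` the product tends to zero. Hence `y 0 0` vanishes for every pair of Gaussian widths,
and letting the widths shrink recovers the solution (`eq_zero_of_smooth_eq_zero`).

Derivatives on `ℝ³` are handled through translations of `L²`: a weak derivative is the derivative of
the translation orbit (`IsWeakDeriv.hasDerivAt`), and integration by parts is the invariance of the
inner product. Only the vertical direction needs traces (`integral_vertical_parts`). -/

/-! ### Averages along a one-parameter group -/

section Averages

variable {H : Type*} [NormedAddCommGroup H] [InnerProductSpace ℝ H]

/-- A strongly continuous one-parameter group of orthogonal maps. -/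
structure IsOrthogonalGroup (U : ℝ → H →L[ℝ] H) : Prop where
  map_zero : ∀ x, U 0 x = x
  map_add : ∀ s t x, U (s + t) x = U s (U t x)
  norm_map : ∀ s x, ‖U s x‖ = ‖x‖
  continuous_orbit : ∀ x, Continuous fun s => U s x

namespace IsOrthogonalGroup

variable {U : ℝ → H →L[ℝ] H} (hU : IsOrthogonalGroup U)

theorem rescale (hU : IsOrthogonalGroup U) (δ : ℝ) : IsOrthogonalGroup fun s => U (δ * s) where
  map_zero x := by simp [hU.map_zero]
  map_add s t x := by simp [mul_add, hU.map_add]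
  norm_map s x := hU.norm_map _ _
  continuous_orbit x := (hU.continuous_orbit x).comp (continuous_const.mul continuous_id)

theorem integrable_smul (hU : IsOrthogonalGroup U) {a : ℝ → ℝ} (ha : Integrable a) (x : H) :
    Integrable fun s => a s • U s x := by
  refine (ha.norm.mul_const ‖x‖).mono'
    (ha.aestronglyMeasurable.smul (hU.continuous_orbit x).aestronglyMeasurable) ?_
  filter_upwards with s
  rw [norm_smul, hU.norm_map]

/-- The average `x ↦ ∫ a(s) U(s) x ds` of the group `U` against the kernel `a`. -/
def average {a : ℝ → ℝ} (ha : Integrable a) : H →L[ℝ] H :=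
  LinearMap.mkContinuous
    { toFun := fun x => ∫ s, a s • U s x
      map_add' := fun x y => by
        simp only [_root_.map_add, smul_add]
        exact integral_add (hU.integrable_smul ha x) (hU.integrable_smul ha y)
      map_smul' := fun c x => by
        simp only [map_smul, RingHom.id_apply]
        rw [← integral_smul]
        exact integral_congr_ae (ae_of_all _ fun s => smul_comm _ _ _) }
    (∫ s, ‖a s‖) fun x => by
      refine (norm_integral_le_integral_norm _).trans ?_
      rw [← integral_mul_const]
      refine le_of_eq (integral_congr_ae (ae_of_all _ fun s => ?_))
      simp only [norm_smul, hU.norm_map]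

theorem average_apply {a : ℝ → ℝ} (ha : Integrable a) (x : H) :
    hU.average ha x = ∫ s, a s • U s x := rfl

theorem norm_average_le {a : ℝ → ℝ} (ha : Integrable a) :
    ‖hU.average ha‖ ≤ ∫ s, ‖a s‖ :=
  LinearMap.mkContinuous_norm_le _ (integral_nonneg fun _ => norm_nonneg _) _

theorem hasDerivAt_orbit (hU : IsOrthogonalGroup U) {x x' : H}
    (hx : HasDerivAt (fun s => U s x) x' 0) (s : ℝ) :
    HasDerivAt (fun s => U s x) (U s x') s := by
  have h1 : HasDerivAt (fun r => U s (U r x)) (U s x') 0 :=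
    (U s).hasFDerivAt.comp_hasDerivAt 0 hx
  have h2 : HasDerivAt (fun r => U s (U (r - s) x)) (U s x') s := by
    have := h1.scomp_of_eq s ((hasDerivAt_id s).sub_const s) (by simp)
    simpa [Function.comp_def] using this
  refine h2.congr_of_eventuallyEq (.of_forall fun r => ?_)
  simp [← hU.map_add]

/-- Integration by parts in the group parameter moves the derivative from the orbit to the kernel.
The generator, which is unbounded, is thereby replaced by a bounded average of `x` itself. -/
theorem average_deriv {a a' : ℝ → ℝ} (ha : Integrable a) (ha' : Integrable a')
    (haa' : ∀ s, HasDerivAt a (a' s) s) {x x' : H}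
    (hx : HasDerivAt (fun s => U s x) x' 0) :
    hU.average ha x' = - hU.average ha' x :=
  integral_bilinear_hasDerivAt_right_eq_neg_left_of_integrable
    (L := ContinuousLinearMap.lsmul ℝ ℝ) (u := a) (v := fun s => U s x)
    (fun s _ => haa' s) (fun s _ => hU.hasDerivAt_orbit hx s)
    (hU.integrable_smul ha x') (hU.integrable_smul ha' x) (hU.integrable_smul ha x)

variable [CompleteSpace H]

theorem average_comm {a : ℝ → ℝ} (ha : Integrable a) (B : H →L[ℝ] H)
    (hB : ∀ s x, B (U s x) = U s (B x)) (x : H) :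
    B (hU.average ha x) = hU.average ha (B x) := by
  rw [average_apply, average_apply, ← B.integral_comp_comm (hU.integrable_smul ha x)]
  simp [hB]

theorem inner_average {a : ℝ → ℝ} (ha : Integrable a) (x y : H) :
    inner ℝ y (hU.average ha x) = ∫ s, a s * inner ℝ y (U s x) := by
  rw [average_apply, ← integral_inner (hU.integrable_smul ha x)]
  simp [inner_smul_right]

/-- Slowing the group by `δ` amounts to concentrating the kernel at width `δ`. Orbits are continuous
and bounded, so dominated convergence applies. -/
theorem tendsto_average_rescale {a : ℝ → ℝ} (ha : Integrable a) (x : H) :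
    Tendsto (fun δ => (hU.rescale δ).average ha x) (𝓝 0) (𝓝 ((∫ s, a s) • x)) := by
  have hlim : (∫ s, a s) • x = ∫ s, a s • U (0 * s) x := by
    simp [hU.map_zero, integral_smul_const]
  rw [hlim]
  refine tendsto_integral_filter_of_dominated_convergence (fun s => ‖a s‖ * ‖x‖) ?_ ?_
    (ha.norm.mul_const _) ?_
  · exact .of_forall fun δ => ((hU.rescale δ).integrable_smul ha x).aestronglyMeasurable
  · refine .of_forall fun δ => ae_of_all _ fun s => ?_
    rw [norm_smul, hU.norm_map]
  · refine ae_of_all _ fun s => ?_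
    refine Tendsto.const_smul ?_ _
    exact ((hU.continuous_orbit x).tendsto _).comp
      ((continuous_id.mul continuous_const).tendsto 0)

theorem eq_zero_of_average_rescale_eq_zero {a : ℝ → ℝ} (ha : Integrable a)
    (ha0 : (∫ s, a s) ≠ 0) {x : H}
    (h : ∀ δ > 0, (hU.rescale δ).average ha x = 0) : x = 0 := by
  have h1 := (hU.tendsto_average_rescale ha x).mono_left (nhdsWithin_le_nhds (s := Ioi 0))
  have h2 : Tendsto (fun δ => (hU.rescale δ).average ha x) (𝓝[>] 0) (𝓝 0) := by
    refine tendsto_const_nhds.congr' ?_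
    filter_upwards [self_mem_nhdsWithin] with δ hδ using (h δ hδ).symm
  exact (smul_eq_zero.1 (tendsto_nhds_unique h1 h2)).resolve_left ha0

end IsOrthogonalGroup

end Averages

/-! ### Derivatives of the Gaussian -/

/-- The `k`-th derivative of `s ↦ exp (-s²)`. -/
def gaussDeriv (k : ℕ) (s : ℝ) : ℝ :=
  (iteratedDeriv k (fun z : ℂ => Complex.exp (-z ^ 2)) s).re

theorem gaussDeriv_zero (s : ℝ) : gaussDeriv 0 s = Real.exp (-s ^ 2) := by
  simp only [gaussDeriv, iteratedDeriv_zero]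
  rw [← Complex.ofReal_pow, ← Complex.ofReal_neg, Complex.exp_ofReal_re]

theorem hasDerivAt_gaussDeriv (k : ℕ) (s : ℝ) :
    HasDerivAt (gaussDeriv k) (gaussDeriv (k + 1) s) s := by
  have hd : ContDiff ℂ ∞ fun z : ℂ => Complex.exp (-z ^ 2) := by fun_prop
  have h1 : HasDerivAt (iteratedDeriv k fun z : ℂ => Complex.exp (-z ^ 2))
      (iteratedDeriv (k + 1) (fun z : ℂ => Complex.exp (-z ^ 2)) s) s := by
    rw [iteratedDeriv_succ]
    exact ((hd.differentiable_iteratedDeriv k (by exact_mod_cast WithTop.coe_lt_top _)) s).hasDerivAt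
  exact h1.real_of_complex

theorem continuous_gaussDeriv (k : ℕ) : Continuous (gaussDeriv k) :=
  continuous_iff_continuousAt.2 fun s => (hasDerivAt_gaussDeriv k s).continuousAt

/-- Cauchy's estimate on the circle of radius `r` about `s`, where `|exp (-z²)| ≤ exp (2r² - s²/2)`.
The radius is arbitrary because the Gaussian is entire; this freedom is what later makes the
argument work on time intervals of any length. -/
theorem abs_gaussDeriv_le {r : ℝ} (hr : 0 < r) (k : ℕ) (s : ℝ) :
    |gaussDeriv k s| ≤ k.factorial * Real.exp (2 * r ^ 2) / r ^ k * Real.exp (-(1 / 2) * s ^ 2) := by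
  refine (Complex.abs_re_le_norm _).trans ?_
  have hd : Differentiable ℂ fun z : ℂ => Complex.exp (-z ^ 2) := by fun_prop
  have := Complex.norm_iteratedDeriv_le_of_forall_mem_sphere_norm_le (c := (s : ℂ)) (R := r)
    (C := Real.exp (2 * r ^ 2) * Real.exp (-(1 / 2) * s ^ 2)) k hr hd.diffContOnCl ?_
  · refine this.trans (le_of_eq ?_)
    ring
  · intro z hz
    rw [Complex.norm_exp, ← Real.exp_add]
    apply Real.exp_le_exp.2
    have hz' : (z.re - s) ^ 2 + z.im ^ 2 = r ^ 2 := by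
      have : ‖z - s‖ = r := by simpa [dist_eq_norm] using hz
      rw [← this, ← Complex.normSq_eq_norm_sq, Complex.normSq_apply]
      simp; ring
    have hre : (-z ^ 2).re = z.im ^ 2 - z.re ^ 2 := by
      simp [pow_two]
    rw [hre]
    -- With `z = x + iy` on the circle, `2r² - s²/2 - (y² - x²) = r² + (2x - s)²/2`.
    nlinarith [sq_nonneg (2 * z.re - s), sq_nonneg (z.re - s)]

theorem integrable_gaussDeriv (k : ℕ) : Integrable (gaussDeriv k) := by
  have hg : Integrable fun s : ℝ => Real.exp (-(1 / 2) * s ^ 2) :=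
    integrable_exp_neg_mul_sq (by norm_num)
  refine (hg.const_mul (k.factorial * Real.exp (2 * 1 ^ 2) / 1 ^ k)).mono'
    (continuous_gaussDeriv k).aestronglyMeasurable (ae_of_all _ fun s => ?_)
  exact abs_gaussDeriv_le one_pos k s

theorem integral_norm_gaussDeriv_le {r : ℝ} (hr : 0 < r) :
    ∃ A : ℝ, 0 ≤ A ∧ ∀ k, ∫ s, ‖gaussDeriv k s‖ ≤ A * (k.factorial / r ^ k) := by
  have hg : Integrable fun s : ℝ => Real.exp (-(1 / 2) * s ^ 2) :=
    integrable_exp_neg_mul_sq (by norm_num)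
  refine ⟨Real.exp (2 * r ^ 2) * ∫ s : ℝ, Real.exp (-(1 / 2) * s ^ 2),
    mul_nonneg (Real.exp_nonneg _) (integral_nonneg fun _ => Real.exp_nonneg _), fun k => ?_⟩
  have := integral_mono (integrable_gaussDeriv k).norm
    (hg.const_mul (k.factorial * Real.exp (2 * r ^ 2) / r ^ k)) (abs_gaussDeriv_le hr k)
  refine this.trans (le_of_eq ?_)
  rw [integral_const_mul]
  ring

theorem integral_gaussDeriv_zero_ne : (∫ s, gaussDeriv 0 s) ≠ 0 := by
  have : (∫ s, gaussDeriv 0 s) = √Real.pi := by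
    have := integral_gaussian 1
    simp only [div_one] at this
    rw [← this]
    simp [gaussDeriv_zero]
  rw [this]
  exact (Real.sqrt_pos.2 Real.pi_pos).ne'

/-! ### A hierarchy of differential inequalities -/

/-- The square root may fail to be differentiable at zeros of `y`, so the comparison is made for
`√(y + ε) - Φ`, which is nonincreasing and starts at `√ε`; then `ε → 0`. -/
theorem sqrt_le_of_deriv_le {y Φ φ : ℝ → ℝ} {b : ℝ} (hy0 : y 0 = 0)
    (hy : ∀ t ∈ Icc 0 b, 0 ≤ y t) (hyc : ContinuousOn y (Icc 0 b))
    (hΦ0 : Φ 0 = 0) (hΦ : ∀ t, HasDerivAt Φ (φ t) t)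
    (hy' : ∀ t ∈ Ioo 0 b, ∃ y', HasDerivAt y y' t ∧ y' ≤ 2 * √(y t) * φ t)
    (hφ : ∀ t ∈ Ioo 0 b, 0 ≤ φ t) :
    ∀ t ∈ Icc 0 b, √(y t) ≤ Φ t := by
  intro t ht
  have key : ∀ ε > 0, √(y t) ≤ Φ t + √ε := by
    intro ε hε
    have hanti : AntitoneOn (fun s => √(y s + ε) - Φ s) (Icc 0 b) := by
      apply antitoneOn_of_deriv_nonpos (convex_Icc 0 b)
      · exact (Real.continuous_sqrt.comp_continuousOn (hyc.add continuousOn_const)).sub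
          (fun s _ => (hΦ s).continuousAt.continuousWithinAt)
      · intro s hs
        rw [interior_Icc] at hs
        obtain ⟨y', h1, -⟩ := hy' s hs
        have hpos : y s + ε ≠ 0 := by have := hy s (Ioo_subset_Icc_self hs); positivity
        exact (((h1.add_const ε).sqrt hpos).sub (hΦ s)).differentiableAt.differentiableWithinAt
      · intro s hs
        rw [interior_Icc] at hs
        obtain ⟨y', h1, h2⟩ := hy' s hs
        have hys := hy s (Ioo_subset_Icc_self hs)
        have hpos : 0 < y s + ε := by positivity
        have hd : HasDerivAt (fun s => √(y s + ε) - Φ s) (y' / (2 * √(y s + ε)) - φ s) s :=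
          ((h1.add_const ε).sqrt hpos.ne').sub (hΦ s)
        rw [hd.deriv]
        have hle : √(y s) ≤ √(y s + ε) := Real.sqrt_le_sqrt (by linarith)
        have h3 : y' ≤ 2 * √(y s + ε) * φ s := h2.trans <| by
          have := mul_le_mul_of_nonneg_right hle (hφ s hs)
          linarith
        have h4 : 0 < 2 * √(y s + ε) := by positivity
        rw [sub_nonpos, div_le_iff₀ h4]
        linarith
    have h := hanti ⟨le_rfl, ht.1.trans ht.2⟩ ht ht.1
    simp only [hy0, hΦ0, zero_add, sub_zero] at h
    have : √(y t) ≤ √(y t + ε) := Real.sqrt_le_sqrt (by linarith)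
    linarith
  have hlim : Tendsto (fun ε : ℝ => Φ t + √ε) (𝓝[>] 0) (𝓝 (Φ t)) := by
    have : Tendsto (fun ε : ℝ => Φ t + √ε) (𝓝 0) (𝓝 (Φ t + √0)) :=
      (continuous_const.add Real.continuous_sqrt).tendsto 0
    simp only [Real.sqrt_zero, add_zero] at this
    exact this.mono_left nhdsWithin_le_nhds
  exact ge_of_tendsto hlim (eventually_mem_nhdsWithin.mono fun ε hε => key ε hε)

/-- Nonnegative functions which start from `0`, control their derivatives by the next ones in the
hierarchy, and grow at most like derivatives of an entire function vanish. -/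
theorem hierarchy_eq_zero {y : ℕ → ℕ → ℝ → ℝ} {b K : ℝ} (hK : 0 < K)
    (hy0 : ∀ j k, y j k 0 = 0) (hy : ∀ j k, ∀ t ∈ Icc 0 b, 0 ≤ y j k t)
    (hyc : ∀ j k, ContinuousOn (y j k) (Icc 0 b))
    (hy' : ∀ j k, ∀ t ∈ Ioo 0 b, ∃ y', HasDerivAt (y j k) y' t ∧
      y' ≤ 2 * √(y j k t) * (K * (√(y j k t) + √(y (j + 1) k t) + √(y j (k + 1) t))))
    (hbd : ∀ r > 0, ∃ A, ∀ j k, ∀ t ∈ Icc 0 b,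
      √(y j k t) ≤ A * ((j + k).factorial / r ^ (j + k))) :
    ∀ t ∈ Icc 0 b, y 0 0 t = 0 := by
  intro t ht
  have hb : 0 ≤ b := ht.1.trans ht.2
  -- The integrating factor removes the diagonal term `√(y j k)` and leaves only the two neighbours
  -- in the hierarchy.
  let z : ℕ → ℕ → ℝ → ℝ := fun j k s => Real.exp (-(2 * K * s)) * y j k s
  have hsqrt : ∀ j k s, √(z j k s) = Real.exp (-(K * s)) * √(y j k s) := by
    intro j k s
    have : Real.exp (-(2 * K * s)) = Real.exp (-(K * s)) ^ 2 := by
      rw [← Real.exp_nat_mul]; congr 1; push_cast; ring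
    simp only [z]
    rw [this, Real.sqrt_mul (sq_nonneg _), Real.sqrt_sq (Real.exp_nonneg _)]
  have hexp : ∀ s, HasDerivAt (fun s => Real.exp (-(2 * K * s)))
      (Real.exp (-(2 * K * s)) * -(2 * K)) s := fun s => by
    have h : HasDerivAt (fun s : ℝ => -(2 * K * s)) (-(2 * K)) s := by
      simpa using ((hasDerivAt_id s).const_mul (2 * K)).fun_neg
    exact h.exp
  have hz' : ∀ j k, ∀ s ∈ Ioo 0 b, ∃ z', HasDerivAt (z j k) z' s ∧
      z' ≤ 2 * √(z j k s) * (K * (√(z (j + 1) k s) + √(z j (k + 1) s))) := by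
    intro j k s hs
    obtain ⟨y', h1, h2⟩ := hy' j k s hs
    refine ⟨_, (hexp s).mul h1, ?_⟩
    rw [hsqrt, hsqrt, hsqrt]
    have hee : Real.exp (-(2 * K * s)) = Real.exp (-(K * s)) * Real.exp (-(K * s)) := by
      rw [← Real.exp_add]; congr 1; ring
    have hyy : √(y j k s) * √(y j k s) = y j k s :=
      Real.mul_self_sqrt (hy j k s (Ioo_subset_Icc_self hs))
    have h3 := mul_le_mul_of_nonneg_left h2 (Real.exp_nonneg (-(2 * K * s)))
    rw [hee] at h3 ⊢
    calc _ = Real.exp (-(K * s)) * Real.exp (-(K * s)) * y'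
          - Real.exp (-(K * s)) * Real.exp (-(K * s)) * (2 * K) * y j k s := by ring
      _ ≤ Real.exp (-(K * s)) * Real.exp (-(K * s)) * (2 * √(y j k s) *
          (K * (√(y j k s) + √(y (j + 1) k s) + √(y j (k + 1) s))))
          - Real.exp (-(K * s)) * Real.exp (-(K * s)) * (2 * K) * y j k s := by linarith
      _ = _ := by linear_combination (2 * K * Real.exp (-(K * s)) * Real.exp (-(K * s))) * hyy
  -- This radius makes `2Kt/r ≤ 1/2` on the whole interval; `b + 1` in place of `b` keeps it
  -- positive when `b = 0`.
  have hr : 0 < 4 * K * (b + 1) := by positivity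
  obtain ⟨A, hA⟩ := hbd _ hr
  have hA0 : 0 ≤ A := by
    have := (Real.sqrt_nonneg _).trans (hA 0 0 0 ⟨le_rfl, hb⟩)
    simpa using this
  set r := 4 * K * (b + 1) with hrdef
  -- Each step integrates the bound for the two neighbours. Both have index sum `j + k + 1`, hence
  -- the same constant, which accounts for the factor `2` in `2 * K`. At `j = k = 0` the two
  -- factorials cancel.
  have claim : ∀ n j k, ∀ s ∈ Icc 0 b, √(z j k s) ≤
      A * ((j + k + n).factorial / r ^ (j + k + n)) * ((2 * K * s) ^ n / n.factorial) := by
    intro n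
    induction n with
    | zero =>
      intro j k s hs
      rw [hsqrt]
      have h1 : Real.exp (-(K * s)) ≤ 1 := Real.exp_le_one_iff.2 (by
        have := mul_nonneg hK.le hs.1; linarith)
      simpa using (mul_le_of_le_one_left (Real.sqrt_nonneg _) h1).trans (hA j k s hs)
    | succ n ih =>
      intro j k
      set c := A * ((j + k + (n + 1)).factorial / r ^ (j + k + (n + 1))) with hc
      have hc0 : 0 ≤ c := by positivity
      refine sqrt_le_of_deriv_le (φ := fun s => c * (2 * K * ((2 * K * s) ^ n / n.factorial)))
        (by simp [z, hy0]) (fun s hs => mul_nonneg (Real.exp_nonneg _) (hy j k s hs))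
        (ContinuousOn.mul (by fun_prop) (hyc j k)) (by simp) ?_ ?_ ?_
      · intro s
        have h1 : HasDerivAt (fun s : ℝ => 2 * K * s) (2 * K) s := by
          simpa using (hasDerivAt_id s).const_mul (2 * K)
        have h2 := ((h1.pow (n + 1)).div_const ((n + 1).factorial : ℝ)).const_mul c
        refine h2.congr_deriv ?_
        rw [Nat.factorial_succ]
        push_cast
        have : (n.factorial : ℝ) ≠ 0 := by positivity
        field_simp
      · intro s hs
        obtain ⟨z', h1, h2⟩ := hz' j k s hs
        refine ⟨z', h1, h2.trans ?_⟩
        have hs' := Ioo_subset_Icc_self hs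
        have e1 := ih (j + 1) k s hs'
        have e2 := ih j (k + 1) s hs'
        rw [show j + 1 + k + n = j + k + (n + 1) by ring] at e1
        rw [show j + (k + 1) + n = j + k + (n + 1) by ring] at e2
        have h0 := Real.sqrt_nonneg (z j k s)
        refine mul_le_mul_of_nonneg_left ?_ (by positivity)
        rw [← hc] at e1 e2
        have := mul_le_mul_of_nonneg_left (add_le_add e1 e2) hK.le
        refine this.trans (le_of_eq (by ring))
      · intro s hs
        have : 0 ≤ s := hs.1.le
        positivity
  have hbound : ∀ n : ℕ, √(z 0 0 t) ≤ A * (1 / 2) ^ n := by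
    intro n
    refine (claim n 0 0 t ht).trans ?_
    have hn : (n.factorial : ℝ) ≠ 0 := by positivity
    rw [mul_assoc]
    refine mul_le_mul_of_nonneg_left ?_ hA0
    have h1 : 2 * K * t / r ≤ 1 / 2 := by
      rw [div_le_iff₀ hr, hrdef]
      nlinarith [ht.2]
    have h2 : 0 ≤ 2 * K * t / r := by have := ht.1; positivity
    calc _ = (2 * K * t / r) ^ n := by
          simp only [zero_add]; rw [div_pow]; field_simp
      _ ≤ _ := pow_le_pow_left₀ h2 h1 n
  have hlim : Tendsto (fun n : ℕ => A * (1 / 2 : ℝ) ^ n) atTop (𝓝 0) := by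
    simpa using (tendsto_pow_atTop_nhds_zero_of_lt_one (by norm_num : (0 : ℝ) ≤ 1 / 2)
      (by norm_num)).const_mul A
  have h0 : √(z 0 0 t) ≤ 0 := ge_of_tendsto' hlim hbound
  rw [hsqrt] at h0
  have h1 : √(y 0 0 t) ≤ 0 := by
    by_contra! h
    exact absurd h0 (not_le.2 (mul_pos (Real.exp_pos _) h))
  exact le_antisymm (Real.sqrt_eq_zero'.1 (le_antisymm h1 (Real.sqrt_nonneg _))) (hy 0 0 t ht)

/-! ### The energy estimate for an abstract evolution in a Hilbert space -/

section Energy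

variable {H : Type*} [NormedAddCommGroup H] [InnerProductSpace ℝ H]

/-- The abstract form of the linearized equations at one instant: `P`, `D`, `G` stand for
`∇(p'(ρ₀) q)`, `(∂ᵢ vᵢ)ᵢ`, `∇η₃` and `F₀`, `F₁` for `∂₁η₁`, `∂₂η₂`; `R` and `Pi` are the multiplications
by `ρ₀` and `p'(ρ₀)`, and the `S j k` are smoothing operators in the horizontal directions. -/
structure EvolvesAt (R Pi : H →L[ℝ] H) (S : ℕ → ℕ → H →L[ℝ] H) (g α κ₀ κ₁ : ℝ)
    (η v : ℝ → Fin 3 → H) (q : ℝ → H) (t : ℝ) (v' P D G : Fin 3 → H) (F₀ F₁ : H) : Prop where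
  deriv_η : ∀ i, HasDerivAt (fun s => η s i) (v t i) t
  deriv_v : ∀ i, HasDerivAt (fun s => v s i) (v' i) t
  deriv_q : HasDerivAt q (-R (∑ i, D i)) t
  momentum_zero : R (v' 0) = -P 0 - g • R (G 0) + (2 * α) • R (v t 1)
  momentum_one : R (v' 1) = -P 1 - g • R (G 1) - (2 * α) • R (v t 0)
  momentum_two : R (v' 2) = -P 2 - g • q t - g • R (G 2)
  vertical : R (G 2) = -q t - R F₀ - R F₁
  smooth_G_zero : ∀ j k, S j k (G 0) = κ₀ • S (j + 1) k (η t 2)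
  smooth_G_one : ∀ j k, S j k (G 1) = κ₁ • S j (k + 1) (η t 2)
  smooth_F_zero : ∀ j k, S j k F₀ = κ₀ • S (j + 1) k (η t 0)
  smooth_F_one : ∀ j k, S j k F₁ = κ₁ • S j (k + 1) (η t 1)
  green : ∀ j k, ∑ i, (inner ℝ (S j k (P i)) (S j k (v t i))
    + inner ℝ (S j k (Pi (q t))) (S j k (D i))) = 0

/-- The energy of a state. -/
def energy (R K : H →L[ℝ] H) (η v : Fin 3 → H) (q : H) : ℝ :=
  ∑ i, inner ℝ (R (v i)) (v i) + inner ℝ (K q) q + ∑ i, inner ℝ (η i) (η i)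

variable {R K Pi : H →L[ℝ] H} {c : ℝ}

theorem norm_le_of_energy (hc : 0 < c) (hc1 : c ≤ 1)
    (hR : ∀ x, c * ‖x‖ ^ 2 ≤ inner ℝ (R x) x) (hK : ∀ x, c * ‖x‖ ^ 2 ≤ inner ℝ (K x) x)
    (η v : Fin 3 → H) (q : H) :
    0 ≤ energy R K η v q ∧ (∀ i, ‖η i‖ ≤ (√c)⁻¹ * √(energy R K η v q)) ∧
      (∀ i, ‖v i‖ ≤ (√c)⁻¹ * √(energy R K η v q)) ∧ ‖q‖ ≤ (√c)⁻¹ * √(energy R K η v q) := by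
  have hv0 : ∀ i, 0 ≤ c * ‖v i‖ ^ 2 := fun i => by positivity
  have hη0 : ∀ i, 0 ≤ ‖η i‖ ^ 2 := fun i => by positivity
  have hcη : ∀ i, c * ‖η i‖ ^ 2 ≤ ‖η i‖ ^ 2 := fun i => mul_le_of_le_one_left (hη0 i) hc1
  have hq0 : 0 ≤ c * ‖q‖ ^ 2 := by positivity
  have hE : energy R K η v q = inner ℝ (R (v 0)) (v 0) + inner ℝ (R (v 1)) (v 1)
      + inner ℝ (R (v 2)) (v 2) + inner ℝ (K q) q + (‖η 0‖ ^ 2 + ‖η 1‖ ^ 2 + ‖η 2‖ ^ 2) := by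
    simp only [energy, Fin.sum_univ_three, real_inner_self_eq_norm_sq]
  have key : ∀ x : H, c * ‖x‖ ^ 2 ≤ energy R K η v q →
      ‖x‖ ≤ (√c)⁻¹ * √(energy R K η v q) := fun x hx => by
    have h1 : √c * ‖x‖ ≤ √(energy R K η v q) := by
      apply Real.le_sqrt_of_sq_le
      rwa [mul_pow, Real.sq_sqrt hc.le]
    rw [inv_mul_eq_div, le_div_iff₀ (Real.sqrt_pos.2 hc), mul_comm]
    exact h1
  have a0 := hR (v 0)
  have a1 := hR (v 1)
  have a2 := hR (v 2)
  have a3 := hK q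
  have b0 := hv0 0
  have b1 := hv0 1
  have b2 := hv0 2
  have d0 := hη0 0
  have d1 := hη0 1
  have d2 := hη0 2
  have e0 := hcη 0
  have e1 := hcη 1
  have e2 := hcη 2
  refine ⟨by linarith, fun i => key _ ?_, fun i => key _ ?_, key _ (by linarith)⟩
  · fin_cases i <;> simp only [Fin.zero_eta, Fin.mk_one, Fin.reduceFinMk] <;> linarith
  · fin_cases i <;> simp only [Fin.zero_eta, Fin.mk_one, Fin.reduceFinMk] <;> linarith

theorem energy_le (η v : Fin 3 → H) (q : H) {M : ℝ} (hη : ∀ i, ‖η i‖ ≤ M) (hv : ∀ i, ‖v i‖ ≤ M)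
    (hq : ‖q‖ ≤ M) : energy R K η v q ≤ (3 * ‖R‖ + ‖K‖ + 3) * M ^ 2 := by
  have h : ∀ (B : H →L[ℝ] H) (x : H), ‖x‖ ≤ M → inner ℝ (B x) x ≤ ‖B‖ * M ^ 2 := fun B x hx => by
    calc inner ℝ (B x) x ≤ ‖B x‖ * ‖x‖ := real_inner_le_norm _ _
      _ ≤ (‖B‖ * ‖x‖) * ‖x‖ := by gcongr; exact B.le_opNorm x
      _ = ‖B‖ * ‖x‖ ^ 2 := by ring
      _ ≤ _ := by gcongr
  have h' : ∀ i, inner ℝ (η i) (η i) ≤ M ^ 2 := fun i => by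
    rw [real_inner_self_eq_norm_sq]
    exact pow_le_pow_left₀ (norm_nonneg _) (hη i) 2
  simp only [energy, Fin.sum_univ_three]
  linarith [h R _ (hv 0), h R _ (hv 1), h R _ (hv 2), h K _ hq, h' 0, h' 1, h' 2]

variable {S : ℕ → ℕ → H →L[ℝ] H} {g α κ₀ κ₁ : ℝ} {η v : ℝ → Fin 3 → H} {q : ℝ → H}

/-- Since `K R = Pi`, the derivative of the `q`-part pairs `Pi q` with the divergence and cancels
the pressure gradient by `green`. The Coriolis terms cancel because `R` is symmetric, and `vertical`
removes both `q` and `G 2` from the third momentum equation. Only terms with one raised index and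
the products of `η` with `v` survive. -/
theorem EvolvesAt.hasDerivAt_energy {t : ℝ} {v' P D G : Fin 3 → H} {F₀ F₁ : H}
    (h : EvolvesAt R Pi S g α κ₀ κ₁ η v q t v' P D G F₀ F₁)
    (hRs : ∀ x y, inner ℝ (R x) y = inner ℝ x (R y))
    (hKs : ∀ x y, inner ℝ (K x) y = inner ℝ x (K y))
    (hPs : ∀ x y, inner ℝ (Pi x) y = inner ℝ x (Pi y))
    (hKR : ∀ x, K (R x) = Pi x)
    (hSR : ∀ j k x, S j k (R x) = R (S j k x))
    (hSP : ∀ j k x, S j k (Pi x) = Pi (S j k x)) (j k : ℕ) :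
    HasDerivAt (fun s => energy R K (fun i => S j k (η s i)) (fun i => S j k (v s i)) (S j k (q s)))
      (2 * (-(g * κ₀ * inner ℝ (R (S (j + 1) k (η t 2))) (S j k (v t 0)))
        - g * κ₁ * inner ℝ (R (S j (k + 1) (η t 2))) (S j k (v t 1))
        + g * κ₀ * inner ℝ (R (S (j + 1) k (η t 0))) (S j k (v t 2))
        + g * κ₁ * inner ℝ (R (S j (k + 1) (η t 1))) (S j k (v t 2))
        + ∑ i, inner ℝ (S j k (η t i)) (S j k (v t i)))) t := by
  have hη := fun i => (S j k).hasFDerivAt.comp_hasDerivAt t (h.deriv_η i)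
  have hv := fun i => (S j k).hasFDerivAt.comp_hasDerivAt t (h.deriv_v i)
  have hRv := fun i => R.hasFDerivAt.comp_hasDerivAt t (hv i)
  have hq := (S j k).hasFDerivAt.comp_hasDerivAt t h.deriv_q
  have hKq := K.hasFDerivAt.comp_hasDerivAt t hq
  have hder := ((HasDerivAt.fun_sum fun i (_ : i ∈ Finset.univ) => (hRv i).inner ℝ (hv i)).add
    (hKq.inner ℝ hq)).add
    (HasDerivAt.fun_sum fun i (_ : i ∈ Finset.univ) => (hη i).inner ℝ (hη i))
  refine hder.congr_deriv ?_
  have e0 : ∀ i, inner ℝ (R (S j k (v t i))) (S j k (v' i))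
      + inner ℝ (R (S j k (v' i))) (S j k (v t i)) = 2 * inner ℝ (S j k (R (v' i))) (S j k (v t i)) := by
    intro i
    rw [hRs, real_inner_comm, hSR]
    ring
  have e1 : ∀ i, inner ℝ (S j k (η t i)) (S j k (v t i))
      + inner ℝ (S j k (v t i)) (S j k (η t i)) = 2 * inner ℝ (S j k (η t i)) (S j k (v t i)) := by
    intro i
    rw [real_inner_comm]
    ring
  have e2 : inner ℝ (K (S j k (q t))) (S j k (-R (∑ i, D i)))
      + inner ℝ (K (S j k (-R (∑ i, D i)))) (S j k (q t))
      = - 2 * ∑ i, inner ℝ (S j k (Pi (q t))) (S j k (D i)) := by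
    rw [hKs, real_inner_comm, map_neg, hSR, map_neg, hKR, inner_neg_left, hPs, ← hSP, map_sum,
      sum_inner]
    simp only [real_inner_comm (S j k (Pi (q t)))]
    ring
  have hg := h.green j k
  have r0 : inner ℝ (R (S j k (v t 1))) (S j k (v t 0))
      = inner ℝ (R (S j k (v t 0))) (S j k (v t 1)) := by
    rw [hRs, real_inner_comm]
  simp only [Function.comp_apply, e0, e1]
  rw [e2]
  simp only [Fin.sum_univ_three] at hg ⊢
  rw [h.momentum_zero, h.momentum_one, h.momentum_two, h.vertical]
  simp only [_root_.map_add, map_sub, map_neg, map_smul, hSR, h.smooth_G_zero, h.smooth_G_one,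
    h.smooth_F_zero, h.smooth_F_one, inner_add_left, inner_sub_left, inner_neg_left,
    real_inner_smul_left]
  linear_combination (-2) * hg + 4 * α * r0

/-- Coercivity and the Cauchy–Schwarz inequality turn the energy identity into the hierarchy of
inequalities, with a constant independent of `j` and `k`. Boundedness of the state on a compact
interval and the bound on `‖S j k‖` give the required growth in `j + k`. -/
theorem eq_zero_of_evolvesAt {b : ℝ} (hc : 0 < c) (hc1 : c ≤ 1)
    (hR : ∀ x, c * ‖x‖ ^ 2 ≤ inner ℝ (R x) x) (hK : ∀ x, c * ‖x‖ ^ 2 ≤ inner ℝ (K x) x)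
    (hRs : ∀ x y, inner ℝ (R x) y = inner ℝ x (R y))
    (hKs : ∀ x y, inner ℝ (K x) y = inner ℝ x (K y))
    (hPs : ∀ x y, inner ℝ (Pi x) y = inner ℝ x (Pi y))
    (hKR : ∀ x, K (R x) = Pi x)
    (hSR : ∀ j k x, S j k (R x) = R (S j k x))
    (hSP : ∀ j k x, S j k (Pi x) = Pi (S j k x))
    (hS : ∀ r > 0, ∃ A, 0 ≤ A ∧ ∀ j k, ‖S j k‖ ≤ A * ((j + k).factorial / r ^ (j + k)))
    (hη : ∀ i, ContinuousOn (fun s => η s i) (Icc 0 b))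
    (hv : ∀ i, ContinuousOn (fun s => v s i) (Icc 0 b)) (hq : ContinuousOn q (Icc 0 b))
    (hη0 : ∀ i, η 0 i = 0) (hv0 : ∀ i, v 0 i = 0) (hq0 : q 0 = 0)
    (hev : ∀ t ∈ Ioo 0 b, ∃ v' P D G F₀ F₁, EvolvesAt R Pi S g α κ₀ κ₁ η v q t v' P D G F₀ F₁) :
    ∀ t ∈ Icc 0 b, (∀ i, S 0 0 (η t i) = 0) ∧ (∀ i, S 0 0 (v t i) = 0) ∧ S 0 0 (q t) = 0 := by
  let y : ℕ → ℕ → ℝ → ℝ := fun j k s =>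
    energy R K (fun i => S j k (η s i)) (fun i => S j k (v s i)) (S j k (q s))
  have hnorm := fun j k s => norm_le_of_energy hc hc1 hR hK (fun i => S j k (η s i))
    (fun i => S j k (v s i)) (S j k (q s))
  have hy0 : ∀ t ∈ Icc 0 b, y 0 0 t = 0 := by
    refine hierarchy_eq_zero (y := y)
      -- Each of `κ₀` and `κ₁` occurs in two gravity terms, the `3` counts the products of `η i`
      -- with `v i`, and the final `1` only ensures positivity.
      (K := (√c)⁻¹ ^ 2 * (2 * |g| * ‖R‖ * (|κ₀| + |κ₁|) + 3) + 1) (by positivity)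
      (fun j k => ?_) (fun j k t _ => (hnorm j k t).1) (fun j k => ?_) (fun j k t ht => ?_) ?_
    · simp [y, energy, hη0, hv0, hq0]
    · have h1 := fun i => (S j k).continuous.comp_continuousOn (hη i)
      have h2 := fun i => (S j k).continuous.comp_continuousOn (hv i)
      have h3 := (S j k).continuous.comp_continuousOn hq
      refine ContinuousOn.add (ContinuousOn.add (continuousOn_finsetSum _ fun i _ => ?_) ?_)
        (continuousOn_finsetSum _ fun i _ => ?_)
      · exact (R.continuous.comp_continuousOn (h2 i)).inner (h2 i)
      · exact (K.continuous.comp_continuousOn h3).inner h3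
      · exact (h1 i).inner (h1 i)
    · obtain ⟨v', P, D, G, F₀, F₁, h⟩ := hev t ht
      refine ⟨_, h.hasDerivAt_energy hRs hKs hPs hKR hSR hSP j k, ?_⟩
      set γ := (√c)⁻¹ with hγ
      have hγ0 : 0 ≤ γ := by positivity
      set n := √(y j k t) with hn
      set n₀ := √(y (j + 1) k t) with hn₀
      set n₁ := √(y j (k + 1) t) with hn₁
      have hnn : 0 ≤ n := Real.sqrt_nonneg _
      have hnn₀ : 0 ≤ n₀ := Real.sqrt_nonneg _
      have hnn₁ : 0 ≤ n₁ := Real.sqrt_nonneg _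
      obtain ⟨-, a1, a2, a3⟩ := hnorm j k t
      obtain ⟨-, b1, -, -⟩ := hnorm (j + 1) k t
      obtain ⟨-, c1, -, -⟩ := hnorm j (k + 1) t
      have hin : ∀ (B : H →L[ℝ] H) (x z : H) (m₁ m₂ C : ℝ), 0 ≤ m₁ → ‖x‖ ≤ γ * m₁ → ‖z‖ ≤ γ * m₂ →
          C * inner ℝ (B x) z ≤ |C| * ‖B‖ * γ ^ 2 * (m₁ * m₂) := by
        intro B x z m₁ m₂ C hm hx hz
        calc C * inner ℝ (B x) z ≤ |C * inner ℝ (B x) z| := le_abs_self _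
          _ = |C| * |inner ℝ (B x) z| := abs_mul _ _
          _ ≤ |C| * (‖B x‖ * ‖z‖) := by gcongr; exact abs_real_inner_le_norm _ _
          _ ≤ |C| * ((‖B‖ * (γ * m₁)) * (γ * m₂)) := by
            gcongr
            exact (B.le_opNorm x).trans (by gcongr)
          _ = _ := by ring
      have t1 := hin R _ _ n₀ n (-(g * κ₀)) hnn₀ (b1 2) (a2 0)
      have t2 := hin R _ _ n₁ n (-(g * κ₁)) hnn₁ (c1 2) (a2 1)
      have t3 := hin R _ _ n₀ n (g * κ₀) hnn₀ (b1 0) (a2 2)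
      have t4 := hin R _ _ n₁ n (g * κ₁) hnn₁ (c1 1) (a2 2)
      have t5 : ∀ i, inner ℝ (S j k (η t i)) (S j k (v t i)) ≤ γ ^ 2 * (n * n) := fun i => by
        calc _ ≤ ‖S j k (η t i)‖ * ‖S j k (v t i)‖ := real_inner_le_norm _ _
          _ ≤ (γ * n) * (γ * n) := by gcongr; exacts [a1 i, a2 i]
          _ = _ := by ring
      rw [abs_neg, abs_mul] at t1 t2
      rw [abs_mul] at t3 t4
      have u0 := t5 0
      have u1 := t5 1
      have u2 := t5 2
      simp only [Fin.sum_univ_three]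
      -- The products `w0` to `w3` are the slack from using a single constant in front of all three
      -- square roots.
      have w0 : 0 ≤ n * n + n * n₀ + n * n₁ := by positivity
      have w1 : 0 ≤ |g| * ‖R‖ * γ ^ 2 * |κ₀| * (n * n + n * n₁) := by positivity
      have w2 : 0 ≤ |g| * ‖R‖ * γ ^ 2 * |κ₁| * (n * n + n * n₀) := by positivity
      have w3 : 0 ≤ γ ^ 2 * (n * n₀ + n * n₁) := by positivity
      linarith
    · intro r hr
      obtain ⟨A, hA0, hA⟩ := hS r hr
      obtain ⟨B, hB0, hB⟩ : ∃ B, 0 ≤ B ∧ ∀ t ∈ Icc 0 b, (∀ i, ‖η t i‖ ≤ B) ∧ (∀ i, ‖v t i‖ ≤ B) ∧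
          ‖q t‖ ≤ B := by
        choose Bη hBη using fun i => isCompact_Icc.exists_bound_of_continuousOn (hη i)
        choose Bv hBv using fun i => isCompact_Icc.exists_bound_of_continuousOn (hv i)
        obtain ⟨Bq, hBq⟩ := isCompact_Icc.exists_bound_of_continuousOn hq
        refine ⟨∑ i, |Bη i| + ∑ i, |Bv i| + |Bq|, by positivity, fun t ht => ⟨fun i => ?_,
          fun i => ?_, ?_⟩⟩
        · have h1 := Finset.single_le_sum (f := fun i => |Bη i|) (fun i _ => abs_nonneg _)
            (Finset.mem_univ i)
          have h2 : 0 ≤ ∑ i, |Bv i| := by positivity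
          have := (hBη i t ht).trans (le_abs_self _)
          linarith [abs_nonneg Bq]
        · have h1 := Finset.single_le_sum (f := fun i => |Bv i|) (fun i _ => abs_nonneg _)
            (Finset.mem_univ i)
          have h2 : 0 ≤ ∑ i, |Bη i| := by positivity
          have := (hBv i t ht).trans (le_abs_self _)
          linarith [abs_nonneg Bq]
        · have h1 : 0 ≤ ∑ i, |Bv i| := by positivity
          have h2 : 0 ≤ ∑ i, |Bη i| := by positivity
          have := (hBq t ht).trans (le_abs_self _)
          linarith
      refine ⟨√(3 * ‖R‖ + ‖K‖ + 3) * B * A, fun j k t ht => ?_⟩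
      obtain ⟨h1, h2, h3⟩ := hB t ht
      have hle : ∀ x : H, ‖x‖ ≤ B → ‖S j k x‖ ≤ A * ((j + k).factorial / r ^ (j + k)) * B :=
        fun x hx => ((S j k).le_opNorm x).trans (by gcongr; exact hA j k)
      have := energy_le (R := R) (K := K) (fun i => S j k (η t i)) (fun i => S j k (v t i))
        (S j k (q t)) (fun i => hle _ (h1 i)) (fun i => hle _ (h2 i)) (hle _ h3)
      refine (Real.sqrt_le_sqrt this).trans (le_of_eq ?_)
      rw [Real.sqrt_mul (by positivity), Real.sqrt_sq (by positivity)]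
      ring
  intro t ht
  obtain ⟨-, a1, a2, a3⟩ := hnorm 0 0 t
  have hyt : energy R K (fun i => S 0 0 (η t i)) (fun i => S 0 0 (v t i)) (S 0 0 (q t)) = 0 :=
    hy0 t ht
  simp only [hyt, Real.sqrt_zero, mul_zero, norm_le_zero_iff] at a1 a2 a3
  exact ⟨a1, a2, a3⟩

end Energy

/-! ### Translations of `L²(ℝ³)` and weak derivatives -/

instance : (volume : Measure Pt).IsAddHaarMeasure :=
  inferInstanceAs ((volume : Measure Hor).prod (volume : Measure ℝ)).IsAddHaarMeasure

/-- `L²(ℝ³)`. -/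
abbrev L2 : Type := Lp ℝ 2 (volume : Measure Pt)

theorem L2.inner_eq (f g : L2) : inner ℝ f g = ∫ x, f x * g x := by
  rw [MeasureTheory.L2.inner_def]
  exact integral_congr_ae (ae_of_all _ fun x => by simp [mul_comm])

theorem L2.locallyIntegrable (f : L2) : LocallyIntegrable f volume :=
  (Lp.memLp f).locallyIntegrable (by norm_num)

/-- The translation `f ↦ f (· + w)`. -/
def translate (w : Pt) : L2 →L[ℝ] L2 :=
  (Lp.compMeasurePreservingₗᵢ ℝ (fun x : Pt => x + w)
    (measurePreserving_add_right volume w)).toContinuousLinearMap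

theorem coeFn_translate (w : Pt) (f : L2) : translate w f =ᵐ[volume] fun x => f (x + w) :=
  Lp.coeFn_compMeasurePreserving f (measurePreserving_add_right volume w)

theorem norm_translate (w : Pt) (f : L2) : ‖translate w f‖ = ‖f‖ :=
  Lp.norm_compMeasurePreserving f (measurePreserving_add_right volume w)

theorem ae_comp_add_right {p : Pt → Prop} (w : Pt) (h : ∀ᵐ x, p x) : ∀ᵐ x : Pt, p (x + w) :=
  (measurePreserving_add_right (volume : Measure Pt) w).quasiMeasurePreserving.ae h

theorem translate_zero (f : L2) : translate 0 f = f := by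
  refine Lp.ext ?_
  filter_upwards [coeFn_translate 0 f] with x hx
  simpa using hx

theorem translate_translate (w w' : Pt) (f : L2) :
    translate w (translate w' f) = translate (w + w') f := by
  refine Lp.ext ?_
  filter_upwards [coeFn_translate w (translate w' f), coeFn_translate (w + w') f,
    ae_comp_add_right w (coeFn_translate w' f)] with x h1 h2 h3
  rw [h1, h2, h3, add_assoc]

theorem inner_translate_translate (w : Pt) (f g : L2) :
    inner ℝ (translate w f) (translate w g) = inner ℝ f g :=
  (Lp.compMeasurePreservingₗᵢ ℝ (fun x : Pt => x + w)
    (measurePreserving_add_right volume w)).inner_map_map f g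

theorem inner_translate_right (w : Pt) (f g : L2) :
    inner ℝ f (translate w g) = inner ℝ (translate (-w) f) g := by
  rw [← inner_translate_translate w (translate (-w) f) g, translate_translate, add_neg_cancel,
    translate_zero]

theorem continuous_translate (f : L2) : Continuous fun w => translate w f := by
  let g : Pt → C(Pt, Pt) := fun w => ⟨fun x => x + w, by fun_prop⟩
  have hg : Continuous g := ContinuousMap.continuous_of_continuous_uncurry g (by
    simp only [g, Function.uncurry_def, ContinuousMap.coe_mk]
    fun_prop)
  exact (continuous_const (y := f)).compMeasurePreservingLp hg
    (fun w => measurePreserving_add_right volume w) (by norm_num)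

theorem isOrthogonalGroup_translate (w : Pt) : IsOrthogonalGroup fun s => translate (s • w) where
  map_zero x := by simp [translate_zero]
  map_add s t x := by rw [translate_translate, add_smul]
  norm_map s x := norm_translate _ _
  continuous_orbit x := (continuous_translate x).comp (by fun_prop)

/-- `g` is the weak derivative of `f` in the direction `w`, on all of `ℝ³`. -/
def IsWeakDeriv (w : Pt) (f g : L2) : Prop :=
  ∀ φ : Pt → ℝ, ContDiff ℝ ∞ φ → HasCompactSupport φ →
    ∫ x, f x * fderiv ℝ φ x w = - ∫ x, g x * φ x

theorem L2.eq_zero_of_integral_eq_zero {f : L2}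
    (h : ∀ φ : Pt → ℝ, ContDiff ℝ ∞ φ → HasCompactSupport φ → ∫ x, f x * φ x = 0) : f = 0 := by
  have := ae_eq_zero_of_integral_contDiff_smul_eq_zero (L2.locallyIntegrable f)
    (fun φ h1 h2 => by simpa [mul_comm] using h φ h1 h2)
  refine Lp.ext ?_
  filter_upwards [this, Lp.coeFn_zero ℝ 2 (volume : Measure Pt)] with x h1 h2
  rw [h1, h2]; rfl

theorem memLp_of_test {φ : Pt → ℝ} (h : Continuous φ) (h' : HasCompactSupport φ) :
    MemLp φ 2 volume := h.memLp_of_hasCompactSupport h'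

theorem inner_toLp (f : L2) {φ : Pt → ℝ} (h : MemLp φ 2 volume) :
    inner ℝ f (h.toLp φ) = ∫ x, f x * φ x := by
  rw [L2.inner_eq]
  refine integral_congr_ae ?_
  filter_upwards [h.coeFn_toLp] with x hx
  rw [hx]

theorem inner_translate_toLp (w : Pt) (f : L2) {φ : Pt → ℝ} (h : MemLp φ 2 volume) :
    inner ℝ (translate w f) (h.toLp φ) = ∫ x, f x * φ (x - w) := by
  rw [inner_toLp]
  have h1 : ∫ x, translate w f x * φ x = ∫ x, f (x + w) * φ (x + w - w) := by
    refine integral_congr_ae ?_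
    filter_upwards [coeFn_translate w f] with x hx
    rw [hx, add_sub_cancel_right]
  rw [h1, integral_add_right_eq_self (fun x => f x * φ (x - w)) w]

/-- The shift is placed on the smooth factor, so differentiation under the integral sign is
legitimate for a merely square integrable `f`. -/
theorem hasDerivAt_integral_shift (f : L2) (w : Pt) {φ : Pt → ℝ} (h : ContDiff ℝ ∞ φ)
    (h' : HasCompactSupport φ) (s : ℝ) :
    HasDerivAt (fun s : ℝ => ∫ x, f x * φ (x - s • w))
      (∫ x, f x * -(fderiv ℝ φ (x - s • w) w)) s := by
  have hd : Differentiable ℝ φ := h.differentiable (by simp)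
  have hcd : Continuous fun x => fderiv ℝ φ x w :=
    (h.continuous_fderiv (by simp)).clm_apply continuous_const
  have hsd : HasCompactSupport fun x => fderiv ℝ φ x w := h'.fderiv_apply ℝ w
  obtain ⟨M, hM⟩ := hsd.exists_bound_of_continuous hcd
  -- A compact set containing the supports of all shifts by parameters within distance `1` of `s`;
  -- the dominating function lives on it.
  let L : Set Pt := (fun p : Pt × ℝ => p.1 + p.2 • w) '' (tsupport φ ×ˢ Icc (s - 1) (s + 1))
  have hL : IsCompact L := (h'.isCompact.prod isCompact_Icc).image (by fun_prop)
  have hmeas : ∀ (ψ : Pt → ℝ), Continuous ψ → ∀ r : ℝ,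
      AEStronglyMeasurable (fun x => f x * ψ (x - r • w)) volume := fun ψ hψ r =>
    (Lp.aestronglyMeasurable f).mul (hψ.comp (by fun_prop)).aestronglyMeasurable
  have hint : Integrable (fun x => f x * φ (x - s • w)) := by
    have h1 : HasCompactSupport fun x : Pt => φ (x - s • w) :=
      h'.comp_homeomorph (Homeomorph.subRight (s • w))
    exact (Lp.memLp f).integrable_mul (q := 2)
      (memLp_of_test (h.continuous.comp (by fun_prop)) h1)
  refine (hasDerivAt_integral_of_dominated_loc_of_deriv_le (μ := volume)
    (F := fun s x => f x * φ (x - s • w)) (F' := fun s x => f x * -(fderiv ℝ φ (x - s • w) w))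
    (bound := L.indicator fun x => ‖f x‖ * M) (Metric.ball_mem_nhds s one_pos)
    (.of_forall fun r => hmeas φ h.continuous r) hint ?_ ?_ ?_ ?_).2
  · exact hmeas (fun x => -(fderiv ℝ φ x w)) hcd.neg s
  · refine ae_of_all _ fun x r hr => ?_
    by_cases hx : x ∈ L
    · rw [indicator_of_mem hx, norm_mul, norm_neg]
      gcongr
      exact hM _
    · rw [indicator_of_notMem hx]
      have : x - r • w ∉ tsupport φ := fun hmem => hx
        ⟨(x - r • w, r), ⟨hmem, by
          rw [Real.ball_eq_Ioo] at hr
          exact Ioo_subset_Icc_self hr⟩, by simp⟩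
      have h0 : fderiv ℝ φ (x - r • w) = 0 :=
        image_eq_zero_of_notMem_tsupport fun hmem => this (tsupport_fderiv_subset ℝ hmem)
      simp [h0]
  · rw [integrable_indicator_iff hL.isClosed.measurableSet]
    exact ((L2.locallyIntegrable f).integrableOn_isCompact hL).norm.mul_const M
  · refine ae_of_all _ fun x r _ => ?_
    have h1 : HasDerivAt (fun r : ℝ => x - r • w) (-w) r := by
      simpa using ((hasDerivAt_id r).smul_const w).const_sub x
    have h2 := (hd (x - r • w)).hasFDerivAt.comp_hasDerivAt r h1
    simpa using h2.const_mul (f x)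

/-- Testing against smooth functions shows that the orbit of `f` is `f` plus the integral of the
orbit of `g`. The latter orbit is continuous in `L²`, so the fundamental theorem of calculus
upgrades the weak derivative to a norm derivative. -/
theorem IsWeakDeriv.hasDerivAt {w : Pt} {f g : L2} (h : IsWeakDeriv w f g) :
    HasDerivAt (fun s : ℝ => translate (s • w) f) g 0 := by
  have hc : Continuous fun s : ℝ => translate (s • w) g :=
    (isOrthogonalGroup_translate w).continuous_orbit g
  have key : ∀ s : ℝ, translate (s • w) f = f + ∫ r in (0 : ℝ)..s, translate (r • w) g := by
    intro s
    rw [← sub_eq_zero]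
    refine L2.eq_zero_of_integral_eq_zero fun φ h1 h2 => ?_
    have hm := memLp_of_test h1.continuous h2
    rw [← inner_toLp _ hm, inner_sub_left, inner_add_left, real_inner_comm,
      real_inner_comm (hm.toLp φ) (∫ r in (0 : ℝ)..s, translate (r • w) g),
      ← innerSL_apply_apply ℝ (hm.toLp φ) (∫ r in (0 : ℝ)..s, translate (r • w) g),
      ← ContinuousLinearMap.intervalIntegral_comp_comm _ (hc.intervalIntegrable _ _)]
    have hder : ∀ r ∈ uIcc 0 s, HasDerivAt
        (fun s : ℝ => inner ℝ (hm.toLp φ) (translate (s • w) f))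
        (innerSL ℝ (hm.toLp φ) (translate (r • w) g)) r := by
      intro r _
      have e1 : (fun s : ℝ => inner ℝ (hm.toLp φ) (translate (s • w) f))
          = fun s : ℝ => ∫ x, f x * φ (x - s • w) := by
        funext s
        rw [real_inner_comm, inner_translate_toLp]
      rw [e1]
      refine (hasDerivAt_integral_shift f w h1 h2 r).congr_deriv ?_
      rw [innerSL_apply_apply, real_inner_comm, inner_translate_toLp]
      have h3 : HasCompactSupport fun x : Pt => φ (x - r • w) :=
        h2.comp_homeomorph (Homeomorph.subRight (r • w))
      have := h (fun x => φ (x - r • w)) (h1.comp (by fun_prop)) h3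
      simp only [fderiv_comp_sub] at this
      simp only [mul_neg, integral_neg, this, neg_neg]
    rw [intervalIntegral.integral_eq_sub_of_hasDerivAt hder
      (((innerSL ℝ (hm.toLp φ)).continuous.comp hc).intervalIntegrable _ _)]
    simp only [zero_smul, translate_zero]
    rw [real_inner_comm f]
    ring
  have : (fun s : ℝ => translate (s • w) f)
      = fun s => f + ∫ r in (0 : ℝ)..s, translate (r • w) g := funext key
  rw [this]
  refine ((hc.integral_hasStrictDerivAt 0 0).hasDerivAt.const_add f).congr_deriv ?_
  simp [translate_zero]

/-- Translations are isometries, so the inner product is constant along the simultaneous orbits; its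
derivative at `0` is the left-hand side. -/
theorem inner_add_inner_eq_zero_of_hasDerivAt {w : Pt} {f f' g g' : L2}
    (hf : HasDerivAt (fun s : ℝ => translate (s • w) f) f' 0)
    (hg : HasDerivAt (fun s : ℝ => translate (s • w) g) g' 0) :
    inner ℝ f' g + inner ℝ f g' = 0 := by
  have h := hf.inner ℝ hg
  simp only [inner_translate_translate, zero_smul, translate_zero] at h
  have := h.unique (hasDerivAt_const (0 : ℝ) (inner ℝ f g))
  linarith

theorem hasDerivAt_translate_comm {w w' : Pt} {f f' : L2}
    (hf : HasDerivAt (fun s : ℝ => translate (s • w) f) f' 0) :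
    HasDerivAt (fun s : ℝ => translate (s • w) (translate w' f)) (translate w' f') 0 := by
  have := (translate w').hasFDerivAt.comp_hasDerivAt 0 hf
  refine this.congr_of_eventuallyEq (.of_forall fun s => ?_)
  simp only [Function.comp_apply, translate_translate, add_comm]

/-! ### Smoothing in the horizontal directions -/

/-- The group of translations in the `i`-th direction, at speed `δ`. -/
theorem isOrthogonalGroup_axis (i : Fin 3) (δ : ℝ) :
    IsOrthogonalGroup fun s => translate ((δ * s) • e i) :=
  (isOrthogonalGroup_translate (e i)).rescale δ

/-- Average of the translates in direction `i` against the `k`-th derivative of a Gaussian of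
width `δ`. -/
def axisSmooth (i : Fin 3) (δ : ℝ) (k : ℕ) : L2 →L[ℝ] L2 :=
  (isOrthogonalGroup_axis i δ).average (integrable_gaussDeriv k)

/-- Averages in both horizontal directions. -/
def smooth (δ₀ δ₁ : ℝ) (j k : ℕ) : L2 →L[ℝ] L2 := axisSmooth 0 δ₀ j ∘L axisSmooth 1 δ₁ k

theorem axisSmooth_comm (i : Fin 3) (δ : ℝ) (k : ℕ) (B : L2 →L[ℝ] L2)
    (hB : ∀ (s : ℝ) f, B (translate (s • e i) f) = translate (s • e i) (B f)) (f : L2) :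
    B (axisSmooth i δ k f) = axisSmooth i δ k (B f) :=
  (isOrthogonalGroup_axis i δ).average_comm _ B (fun _ _ => hB _ _) f

theorem axisSmooth_translate (i : Fin 3) (δ : ℝ) (k : ℕ) (w : Pt) (f : L2) :
    translate w (axisSmooth i δ k f) = axisSmooth i δ k (translate w f) :=
  axisSmooth_comm i δ k _ (fun s f => by simp only [translate_translate, add_comm]) f

theorem smooth_comm (δ₀ δ₁ : ℝ) (j k : ℕ) (B : L2 →L[ℝ] L2)
    (hB : ∀ w : Pt, w.2 = 0 → ∀ f, B (translate w f) = translate w (B f)) (f : L2) :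
    smooth δ₀ δ₁ j k (B f) = B (smooth δ₀ δ₁ j k f) := by
  simp only [smooth, ContinuousLinearMap.comp_apply]
  rw [axisSmooth_comm 0 δ₀ j B, axisSmooth_comm 1 δ₁ k B]
  · intro s f
    exact hB _ (by simp [e]) f
  · intro s f
    exact hB _ (by simp [e]) f

/-- The derivative is traded for one more derivative of the Gaussian; the factor `δ⁻¹` comes from
running the translations at speed `δ`. -/
theorem axisSmooth_deriv {i : Fin 3} {δ : ℝ} (hδ : δ ≠ 0) (k : ℕ) {f f' : L2}
    (hf : HasDerivAt (fun s : ℝ => translate (s • e i) f) f' 0) :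
    axisSmooth i δ k f' = (-δ⁻¹) • axisSmooth i δ (k + 1) f := by
  have h1 : HasDerivAt (fun s : ℝ => translate ((δ * s) • e i) f) (δ • f') 0 := by
    have h2 : HasDerivAt (fun s : ℝ => δ * s) δ 0 := by
      simpa using (hasDerivAt_id (0 : ℝ)).const_mul δ
    exact HasDerivAt.scomp_of_eq (0 : ℝ) hf h2 (by simp)
  have := (isOrthogonalGroup_axis i δ).average_deriv (integrable_gaussDeriv k)
    (integrable_gaussDeriv (k + 1)) (hasDerivAt_gaussDeriv k) h1
  rw [map_smul] at this
  rw [neg_smul, ← smul_neg]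
  exact (eq_inv_smul_iff₀ hδ).2 this

theorem smooth_deriv_zero {δ₀ δ₁ : ℝ} (hδ : δ₀ ≠ 0) (j k : ℕ) {f f' : L2}
    (hf : HasDerivAt (fun s : ℝ => translate (s • e 0) f) f' 0) :
    smooth δ₀ δ₁ j k f' = (-δ₀⁻¹) • smooth δ₀ δ₁ (j + 1) k f := by
  refine axisSmooth_deriv hδ j ?_
  have := (axisSmooth 1 δ₁ k).hasFDerivAt.comp_hasDerivAt 0 hf
  refine this.congr_of_eventuallyEq (.of_forall fun s => ?_)
  exact axisSmooth_translate _ _ _ _ _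

theorem smooth_deriv_one {δ₀ δ₁ : ℝ} (hδ : δ₁ ≠ 0) (j k : ℕ) {f f' : L2}
    (hf : HasDerivAt (fun s : ℝ => translate (s • e 1) f) f' 0) :
    smooth δ₀ δ₁ j k f' = (-δ₁⁻¹) • smooth δ₀ δ₁ j (k + 1) f := by
  simp only [smooth, ContinuousLinearMap.comp_apply]
  rw [axisSmooth_deriv hδ k hf, map_smul]

/-- The one-directional bounds multiply, and `j! k! ≤ (j + k)!` makes the result depend on `j + k`
alone, as the hierarchy requires. -/
theorem norm_smooth_le (δ₀ δ₁ : ℝ) {r : ℝ} (hr : 0 < r) :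
    ∃ A, 0 ≤ A ∧ ∀ j k, ‖smooth δ₀ δ₁ j k‖ ≤ A * ((j + k).factorial / r ^ (j + k)) := by
  obtain ⟨A, hA0, hA⟩ := integral_norm_gaussDeriv_le hr
  refine ⟨A * A, by positivity, fun j k => ?_⟩
  have h1 : ∀ i δ k, ‖axisSmooth i δ k‖ ≤ A * (k.factorial / r ^ k) := fun i δ k =>
    ((isOrthogonalGroup_axis i δ).norm_average_le _).trans (hA k)
  have h2 : (j.factorial : ℝ) * k.factorial ≤ (j + k).factorial := by
    exact_mod_cast Nat.le_of_dvd (Nat.factorial_pos _) (Nat.factorial_mul_factorial_dvd_factorial_add j k)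
  calc ‖smooth δ₀ δ₁ j k‖ ≤ ‖axisSmooth 0 δ₀ j‖ * ‖axisSmooth 1 δ₁ k‖ :=
        ContinuousLinearMap.opNorm_comp_le _ _
    _ ≤ (A * (j.factorial / r ^ j)) * (A * (k.factorial / r ^ k)) := by
        gcongr <;> apply h1
    _ = A * A * ((j.factorial * k.factorial) / r ^ (j + k)) := by rw [pow_add]; field_simp
    _ ≤ _ := by gcongr

/-- For fixed `δ₁` let `δ₀` tend to zero, then let `δ₁` tend to zero. -/
theorem eq_zero_of_smooth_eq_zero {f : L2}
    (h : ∀ δ₀ > 0, ∀ δ₁ > 0, smooth δ₀ δ₁ 0 0 f = 0) : f = 0 := by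
  refine (isOrthogonalGroup_translate (e 1)).eq_zero_of_average_rescale_eq_zero
    (integrable_gaussDeriv 0) integral_gaussDeriv_zero_ne fun δ₁ hδ₁ => ?_
  exact (isOrthogonalGroup_translate (e 0)).eq_zero_of_average_rescale_eq_zero
    (integrable_gaussDeriv 0) integral_gaussDeriv_zero_ne fun δ₀ hδ₀ => h δ₀ hδ₀ δ₁ hδ₁

/-! ### Integration by parts after horizontal smoothing -/

/-- The pairings `⟪x₁, y₁⟫ + ⟪x₂, y₂⟫` vanish for all horizontal translates of `(y₁, y₂)`. -/
def TranslatesOrthogonal (x₁ x₂ y₁ y₂ : L2) : Prop :=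
  ∀ w : Pt, w.2 = 0 → inner ℝ x₁ (translate w y₁) + inner ℝ x₂ (translate w y₂) = 0

namespace TranslatesOrthogonal

variable {x₁ x₂ y₁ y₂ : L2}

theorem symm (h : TranslatesOrthogonal x₁ x₂ y₁ y₂) : TranslatesOrthogonal y₁ y₂ x₁ x₂ := by
  intro w hw
  rw [real_inner_comm, ← neg_neg w, ← inner_translate_right, real_inner_comm _ y₂,
    ← neg_neg w, neg_neg (-w), ← inner_translate_right]
  exact h (-w) (by simp [hw])

theorem axisSmooth (h : TranslatesOrthogonal x₁ x₂ y₁ y₂) {i : Fin 3} (hi : (e i).2 = 0) (δ : ℝ)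
    (k : ℕ) : TranslatesOrthogonal x₁ x₂ (axisSmooth i δ k y₁) (axisSmooth i δ k y₂) := by
  intro w hw
  have hG := isOrthogonalGroup_axis i δ
  have ha := integrable_gaussDeriv k
  have hI : ∀ x y : L2, Integrable fun s : ℝ =>
      gaussDeriv k s * inner ℝ x (translate ((δ * s) • e i) y) := fun x y => by
    have := (innerSL ℝ x).integrable_comp (hG.integrable_smul ha y)
    simpa [inner_smul_right] using this
  rw [axisSmooth_translate, axisSmooth_translate, RotatingRT.axisSmooth, hG.inner_average,
    hG.inner_average, ← integral_add (hI _ _) (hI _ _)]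
  refine integral_eq_zero_of_ae (ae_of_all _ fun s => ?_)
  have := h ((δ * s) • e i + w) (by simp [hi, hw])
  simp only [translate_translate, Pi.zero_apply]
  linear_combination gaussDeriv k s * this

/-- Averaging one pair integrates the identities over translates and preserves the whole family.
Exchanging the pairs by `symm` allows the other one to be smoothed as well. -/
theorem smooth (h : TranslatesOrthogonal x₁ x₂ y₁ y₂) (δ₀ δ₁ : ℝ) (j k : ℕ) :
    inner ℝ (smooth δ₀ δ₁ j k x₁) (smooth δ₀ δ₁ j k y₁)
      + inner ℝ (smooth δ₀ δ₁ j k x₂) (smooth δ₀ δ₁ j k y₂) = 0 := by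
  have h0 : (e 0).2 = 0 := by simp [e]
  have h1 : (e 1).2 = 0 := by simp [e]
  have := ((((h.axisSmooth h1 δ₁ k).axisSmooth h0 δ₀ j).symm.axisSmooth h1 δ₁ k).axisSmooth
    h0 δ₀ j).symm 0 rfl
  simp only [translate_zero] at this
  exact this

end TranslatesOrthogonal

theorem translatesOrthogonal_of_hasDerivAt {w : Pt} {f f' g g' : L2}
    (hf : HasDerivAt (fun s : ℝ => translate (s • w) f) f' 0)
    (hg : HasDerivAt (fun s : ℝ => translate (s • w) g) g' 0) :
    TranslatesOrthogonal f' f g g' := fun _ _ =>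
  inner_add_inner_eq_zero_of_hasDerivAt hf (hasDerivAt_translate_comm hg)

/-! ### Cutoff functions and weak derivatives on an interval -/

theorem exists_cutoff {K O : Set ℝ} (hK : IsCompact K) (hO : IsOpen O) (hKO : K ⊆ O) :
    ∃ χ : ℝ → ℝ, ContDiff ℝ ∞ χ ∧ HasCompactSupport χ ∧ tsupport χ ⊆ O ∧ (∀ z ∈ K, χ z = 1) ∧
      ∀ z, |χ z| ≤ 1 := by
  obtain ⟨L, hL, hKL, hLO⟩ := exists_compact_between hK hO hKO
  obtain ⟨χ, h1, h0, h01⟩ := exists_contMDiffMap_one_nhds_of_subset_interior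
    (modelWithCornersSelf ℝ ℝ) hK.isClosed hKL (n := ⊤)
  have hsupp : tsupport χ ⊆ L := closure_minimal
    (fun z hz => by by_contra hzL; exact hz (h0 z hzL)) hL.isClosed
  exact ⟨χ, χ.contMDiff.contDiff, hL.of_isClosed_subset (isClosed_tsupport _) hsupp,
    hsupp.trans hLO, fun z hz => h1.self_of_nhdsSet z hz,
    fun z => abs_le.2 ⟨by linarith [(h01 z).1], (h01 z).2⟩⟩

/-- One-sided intervals have positive measure. This makes one-sided limits along almost every height
unique. -/
instance neBot_nhdsGT_inf_ae (a : ℝ) : (𝓝[>] a ⊓ ae (volume : Measure ℝ)).NeBot := by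
  rw [inf_neBot_iff]
  intro s hs t ht
  obtain ⟨b, hb, hbs⟩ := mem_nhdsGT_iff_exists_Ioo_subset.1 hs
  by_contra hne
  rw [not_nonempty_iff_eq_empty] at hne
  have hsub : Ioo a b ⊆ tᶜ := fun z hz hzt => by
    have : z ∈ s ∩ t := ⟨hbs hz, hzt⟩
    rw [hne] at this
    exact this
  have h0 := measure_mono_null hsub (mem_ae_iff.1 ht)
  rw [Real.volume_Ioo, ENNReal.ofReal_eq_zero] at h0
  exact absurd (sub_pos.2 hb) (not_lt.2 h0)

instance neBot_nhdsLT_inf_ae (a : ℝ) : (𝓝[<] a ⊓ ae (volume : Measure ℝ)).NeBot := by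
  rw [inf_neBot_iff]
  intro s hs t ht
  obtain ⟨b, hb, hbs⟩ := mem_nhdsLT_iff_exists_Ioo_subset.1 hs
  by_contra hne
  rw [not_nonempty_iff_eq_empty] at hne
  have hsub : Ioo b a ⊆ tᶜ := fun z hz hzt => by
    have : z ∈ s ∩ t := ⟨hbs hz, hzt⟩
    rw [hne] at this
    exact this
  have h0 := measure_mono_null hsub (mem_ae_iff.1 ht)
  rw [Real.volume_Ioo, ENNReal.ofReal_eq_zero] at h0
  exact absurd (sub_pos.2 hb) (not_lt.2 h0)

/-- The du Bois-Reymond lemma. Subtracting from a test function its mean times a fixed bump `β` of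
mass one leaves a function of mean zero, whose primitive is again a test function. Hence `U` minus
its pairing with `β` is orthogonal to all test functions. -/
theorem ae_eq_const_of_integral_mul_deriv_eq_zero {a b : ℝ} (hab : a < b) {U : ℝ → ℝ}
    (hU : IntegrableOn U (Ioo a b))
    (h : ∀ χ : ℝ → ℝ, ContDiff ℝ ∞ χ → HasCompactSupport χ → tsupport χ ⊆ Ioo a b →
      ∫ z in Ioo a b, U z * deriv χ z = 0) :
    ∃ c, ∀ᵐ z, z ∈ Ioo a b → U z = c := by
  obtain ⟨β, hβ, hβc, hβs, hβ1⟩ : ∃ β : ℝ → ℝ, ContDiff ℝ ∞ β ∧ HasCompactSupport β ∧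
      tsupport β ⊆ Ioo a b ∧ ∫ z in a..b, β z = 1 := by
    have hm : (a + b) / 2 ∈ Ioo a b := ⟨by linarith, by linarith⟩
    obtain ⟨f, hf, hfc, hfd, hf01, hf1⟩ := exists_contDiff_tsupport_subset (n := ⊤)
      (isOpen_Ioo.mem_nhds hm)
    have hf0 : ∀ z, 0 ≤ f z := fun z => (hf01 (mem_range_self z)).1
    have hpos : 0 < ∫ z in a..b, f z := by
      refine intervalIntegral.integral_pos hab hfd.continuous.continuousOn (fun z _ => hf0 z)
        ⟨_, Ioo_subset_Icc_self hm, ?_⟩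
      rw [hf1]; exact one_pos
    refine ⟨fun z => (∫ z in a..b, f z)⁻¹ * f z, contDiff_const.mul hfd, hfc.mul_left,
      (tsupport_mul_subset_right (f := fun _ => (∫ z in a..b, f z)⁻¹) (g := f)).trans hf, ?_⟩
    rw [intervalIntegral.integral_const_mul, inv_mul_cancel₀ hpos.ne']
  have hmulint : ∀ θ : ℝ → ℝ, Continuous θ → HasCompactSupport θ →
      IntegrableOn (fun z => U z * θ z) (Ioo a b) := fun θ h1 h2 => by
    obtain ⟨M, hM⟩ := h2.exists_bound_of_continuous h1
    exact hU.mul_bdd (c := M) h1.aestronglyMeasurable (ae_of_all _ hM)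
  refine ⟨∫ z in Ioo a b, U z * β z, ?_⟩
  set c := ∫ z in Ioo a b, U z * β z with hc
  have key : ∀ θ : ℝ → ℝ, ContDiff ℝ ∞ θ → HasCompactSupport θ → tsupport θ ⊆ Ioo a b →
      ∫ z in Ioo a b, U z * θ z = (∫ z in a..b, θ z) * c := by
    intro θ hθ hθc hθs
    set I := ∫ z in a..b, θ z with hI
    let ψ : ℝ → ℝ := fun z => θ z - I * β z
    have hψ : ContDiff ℝ ∞ ψ := hθ.sub (contDiff_const.mul hβ)
    have hψi : ∀ p q, IntervalIntegrable ψ volume p q := fun p q =>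
      hψ.continuous.intervalIntegrable _ _
    let χ : ℝ → ℝ := fun z => ∫ y in a..z, ψ y
    have hχd : ∀ z, HasDerivAt χ (ψ z) z := fun z =>
      (hψ.continuous.integral_hasStrictDerivAt a z).hasDerivAt
    have hχ : ContDiff ℝ ∞ χ := by
      rw [contDiff_infty_iff_deriv]
      refine ⟨fun z => (hχd z).differentiableAt, ?_⟩
      rwa [show deriv χ = ψ from funext fun z => (hχd z).deriv]
    have hψ0 : ∫ z in a..b, ψ z = 0 := by
      have hβi : IntervalIntegrable (fun z => I * β z) volume a b :=
        (continuous_const.mul hβ.continuous).intervalIntegrable _ _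
      rw [intervalIntegral.integral_sub (hθ.continuous.intervalIntegrable _ _) hβi,
        intervalIntegral.integral_const_mul, hβ1, ← hI]
      ring
    obtain ⟨p, hp⟩ : ∃ p, p = tsupport θ ∪ tsupport β := ⟨_, rfl⟩
    have hpc : IsCompact p := hp ▸ hθc.isCompact.union hβc.isCompact
    have hps : p ⊆ Ioo a b := hp ▸ union_subset hθs hβs
    have hψp : ∀ z, z ∉ p → ψ z = 0 := fun z hz => by
      rw [hp, mem_union, not_or] at hz
      simp only [ψ, image_eq_zero_of_notMem_tsupport hz.1, image_eq_zero_of_notMem_tsupport hz.2,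
        mul_zero, sub_zero]
    obtain ⟨a', b', ha', hb', hpab⟩ : ∃ a' b', a < a' ∧ b' < b ∧ p ⊆ Icc a' b' := by
      rcases p.eq_empty_or_nonempty with he | hne
      -- With nothing to enclose, the reversed endpoints satisfy both strict inequalities and
      -- describe an empty interval.
      · exact ⟨b, a, hab, hab, by simp [he]⟩
      · exact ⟨sInf p, sSup p, (hps (hpc.sInf_mem hne)).1, (hps (hpc.sSup_mem hne)).2,
          fun z hz => ⟨csInf_le hpc.bddBelow hz, le_csSup hpc.bddAbove hz⟩⟩
    have hχs : Function.support χ ⊆ Icc a' b' := by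
      intro z hz
      by_contra hz'
      apply hz
      rw [mem_Icc, not_and_or, not_le, not_le] at hz'
      rcases hz' with h1 | h1
      · refine intervalIntegral.integral_zero_ae (ae_of_all _ fun y hy => hψp y fun hyp => ?_)
        have h2 := (hpab hyp).1
        rcases le_total a z with haz | haz
        · rw [uIoc_of_le haz] at hy; linarith [hy.2]
        · rw [uIoc_of_ge haz] at hy; linarith [hy.2]
      · have h3 : χ z = χ z - ∫ y in a..b, ψ y := by rw [hψ0, sub_zero]
        rw [h3, intervalIntegral.integral_interval_sub_left (hψi _ _) (hψi _ _)]
        refine intervalIntegral.integral_zero_ae (ae_of_all _ fun y hy => hψp y fun hyp => ?_)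
        have h2 := (hpab hyp).2
        rcases le_total b z with hbz | hbz
        · rw [uIoc_of_le hbz] at hy; linarith [hy.1]
        · rw [uIoc_of_ge hbz] at hy; linarith [hy.1]
    have hχt : tsupport χ ⊆ Icc a' b' := closure_minimal hχs isClosed_Icc
    have hz := h χ hχ (isCompact_Icc.of_isClosed_subset (isClosed_tsupport _) hχt)
      (hχt.trans (Icc_subset_Ioo ha' hb'))
    have e1 : ∀ z, U z * deriv χ z = U z * θ z - I * (U z * β z) := fun z => by
      rw [(hχd z).deriv]; simp only [ψ]; ring
    simp only [e1] at hz
    rw [integral_sub (hmulint θ hθ.continuous hθc) ((hmulint β hβ.continuous hβc).const_mul I),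
      integral_const_mul] at hz
    linarith
  have hloc : LocallyIntegrableOn (fun z => U z - c) (Ioo a b) :=
    (hU.sub (integrableOn_const (by simp))).locallyIntegrableOn
  have := isOpen_Ioo.ae_eq_zero_of_integral_contDiff_smul_eq_zero hloc (fun θ h1 h2 h3 => by
    have e2 : ∫ z, θ z • (U z - c) = ∫ z in Ioo a b, θ z • (U z - c) := by
      rw [setIntegral_eq_integral_of_forall_compl_eq_zero]
      intro z hz
      rw [image_eq_zero_of_notMem_tsupport fun hz' => hz (h3 hz'), zero_smul]
    have e3 : ∀ z, θ z • (U z - c) = U z * θ z - c * θ z := fun z => by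
      rw [smul_eq_mul]; ring
    rw [e2]
    simp only [e3]
    rw [integral_sub (hmulint θ h1.continuous h2)
      ((h1.continuous.integrable_of_hasCompactSupport h2).integrableOn.const_mul c),
      integral_const_mul, key θ h1 h2 h3, intervalIntegral.integral_of_le hab.le,
      integral_Ioc_eq_integral_Ioo]
    ring)
  filter_upwards [this] with z hz hz'
  linarith [hz hz']

/-- A function on an interval with an integrable weak derivative is, almost everywhere, the
integral of this derivative. -/
theorem exists_ae_eq_add_integral {a b : ℝ} (hab : a < b) {u w : ℝ → ℝ}
    (hu : IntegrableOn u (Ioo a b)) (hw : IntegrableOn w (Ioo a b))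
    (h : ∀ χ : ℝ → ℝ, ContDiff ℝ ∞ χ → HasCompactSupport χ → tsupport χ ⊆ Ioo a b →
      ∫ z in Ioo a b, u z * deriv χ z = - ∫ z in Ioo a b, w z * χ z) :
    ∃ c, ∀ᵐ z, z ∈ Ioo a b → u z = c + ∫ y in a..z, w y := by
  have hwi : IntervalIntegrable w volume a b := by
    rwa [intervalIntegrable_iff_integrableOn_Ioo_of_le hab.le]
  have hWc : ContinuousOn (fun z => ∫ y in a..z, w y) (Icc a b) := by
    have := intervalIntegral.continuousOn_primitive_interval (μ := volume) (f := w) (a := a)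
      (b := b) (by rw [uIcc_of_le hab.le]; rwa [integrableOn_Icc_iff_integrableOn_Ioo])
    rwa [uIcc_of_le hab.le] at this
  have hWi : IntegrableOn (fun z => ∫ y in a..z, w y) (Ioo a b) :=
    (hWc.integrableOn_Icc).mono_set Ioo_subset_Icc_self
  -- The primitive of `w` is absolutely continuous, so integration by parts against `χ`, which
  -- vanishes at both ends, shows that `u` minus this primitive has zero weak derivative.
  obtain ⟨c, hc⟩ := ae_eq_const_of_integral_mul_deriv_eq_zero hab (hu.sub hWi) (by
    intro χ h1 h2 h3
    have hd : Continuous (deriv χ) := h1.continuous_deriv (by simp)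
    obtain ⟨M, hM⟩ := h2.deriv.exists_bound_of_continuous hd
    have hi : ∀ v : ℝ → ℝ, IntegrableOn v (Ioo a b) →
        IntegrableOn (fun z => v z * deriv χ z) (Ioo a b) := fun v hv =>
      hv.mul_bdd (c := M) hd.aestronglyMeasurable (ae_of_all _ hM)
    have hAC := hwi.absolutelyContinuousOnInterval_intervalIntegral (c := a) (by simp)
    have hχAC : AbsolutelyContinuousOnInterval χ a b :=
      (h1.of_le (by simp)).contDiffOn.absolutelyContinuousOnInterval
    have hparts := hAC.integral_mul_deriv_eq_deriv_mul hχAC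
    have hχa : χ a = 0 := image_eq_zero_of_notMem_tsupport fun ha => lt_irrefl _ (h3 ha).1
    have hχb : χ b = 0 := image_eq_zero_of_notMem_tsupport fun hb => lt_irrefl _ (h3 hb).2
    rw [hχa, hχb] at hparts
    have e1 : ∫ z in a..b, deriv (fun z => ∫ y in a..z, w y) z * χ z = ∫ z in a..b, w z * χ z := by
      refine intervalIntegral.integral_congr_ae ?_
      filter_upwards [hwi.ae_hasDerivAt_integral] with z hz hz'
      rw [(hz (uIoc_subset_uIcc hz') a (by simp)).deriv]
    rw [e1] at hparts
    simp only [intervalIntegral.integral_of_le hab.le, integral_Ioc_eq_integral_Ioo] at hparts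
    simp only [Pi.sub_apply, sub_mul]
    rw [integral_sub (hi u hu) (hi _ hWi), h χ h1 h2 h3]
    rw [hparts]
    ring)
  exact ⟨c, hc.mono fun z hz hz' => by have := hz hz'; simp only [Pi.sub_apply] at this; linarith⟩

/-- The primitive representative is continuous up to both endpoints. As `u` agrees with it only
almost everywhere, the limits are taken off a null set. -/
theorem exists_tendsto_of_weak_deriv {a b : ℝ} (hab : a < b) {u w : ℝ → ℝ}
    (hu : IntegrableOn u (Ioo a b)) (hw : IntegrableOn w (Ioo a b))
    (h : ∀ χ : ℝ → ℝ, ContDiff ℝ ∞ χ → HasCompactSupport χ → tsupport χ ⊆ Ioo a b →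
      ∫ z in Ioo a b, u z * deriv χ z = - ∫ z in Ioo a b, w z * χ z) :
    ∃ c, Tendsto u (𝓝[>] a ⊓ ae volume) (𝓝 c) ∧
      Tendsto u (𝓝[<] b ⊓ ae volume) (𝓝 (c + ∫ z in Ioo a b, w z)) := by
  obtain ⟨c, hc⟩ := exists_ae_eq_add_integral hab hu hw h
  have hWc : ContinuousOn (fun z => c + ∫ y in a..z, w y) (Icc a b) := by
    have := intervalIntegral.continuousOn_primitive_interval (μ := volume) (f := w) (a := a)
      (b := b) (by rw [uIcc_of_le hab.le]; rwa [integrableOn_Icc_iff_integrableOn_Ioo])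
    rw [uIcc_of_le hab.le] at this
    exact continuousOn_const.add this
  refine ⟨c, ?_, ?_⟩
  · have h1 : Tendsto (fun z => c + ∫ y in a..z, w y) (𝓝[>] a) (𝓝 c) := by
      have := (hWc a (left_mem_Icc.2 hab.le)).mono_left
        (nhdsWithin_le_of_mem (mem_of_superset (Ioo_mem_nhdsGT hab) Ioo_subset_Icc_self))
      simpa using this
    refine (h1.mono_left inf_le_left).congr' ?_
    filter_upwards [mem_inf_of_left (Ioo_mem_nhdsGT hab), mem_inf_of_right hc] with z hz1 hz2
    exact (hz2 hz1).symm
  · have h1 : Tendsto (fun z => c + ∫ y in a..z, w y) (𝓝[<] b)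
        (𝓝 (c + ∫ z in Ioo a b, w z)) := by
      have := (hWc b (right_mem_Icc.2 hab.le)).mono_left
        (nhdsWithin_le_of_mem (mem_of_superset (Ioo_mem_nhdsLT hab) Ioo_subset_Icc_self))
      rwa [← integral_Ioc_eq_integral_Ioo, ← intervalIntegral.integral_of_le hab.le]
    refine (h1.mono_left inf_le_left).congr' ?_
    filter_upwards [mem_inf_of_left (Ioo_mem_nhdsLT hab), mem_inf_of_right hc] with z hz1 hz2
    exact (hz2 hz1).symm

/-! ### Extension by zero -/

open scoped Classical in
/-- The extension by zero of `f|_s`, as an element of `L²(ℝ³)`. -/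
def extendZero (s : Set Pt) (f : Pt → ℝ) : L2 :=
  if h : MemLp (s.indicator f) 2 volume then h.toLp _ else 0

variable {s : Set Pt} {f g : Pt → ℝ}

theorem memLp_indicator (hs : MeasurableSet s) (hf : MemLp f 2 (volume.restrict s)) :
    MemLp (s.indicator f) 2 volume := (memLp_indicator_iff_restrict hs).2 hf

theorem coeFn_extendZero (hs : MeasurableSet s) (hf : MemLp f 2 (volume.restrict s)) :
    extendZero s f =ᵐ[volume] s.indicator f := by
  rw [extendZero, dif_pos (memLp_indicator hs hf)]
  exact MemLp.coeFn_toLp _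

theorem integral_extendZero_mul (hs : MeasurableSet s) (hf : MemLp f 2 (volume.restrict s))
    (φ : Pt → ℝ) : ∫ x, extendZero s f x * φ x = ∫ x in s, f x * φ x := by
  rw [← integral_indicator hs]
  refine integral_congr_ae ?_
  filter_upwards [coeFn_extendZero hs hf] with x hx
  rw [hx]
  by_cases h : x ∈ s <;> simp [h]

theorem inner_extendZero (hs : MeasurableSet s) (hf : MemLp f 2 (volume.restrict s))
    (hg : MemLp g 2 (volume.restrict s)) :
    inner ℝ (extendZero s f) (extendZero s g) = ∫ x in s, f x * g x := by
  rw [L2.inner_eq, integral_extendZero_mul hs hf, ← integral_indicator hs, ← integral_indicator hs]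
  refine integral_congr_ae ?_
  filter_upwards [coeFn_extendZero hs hg] with x hx
  by_cases h : x ∈ s <;> simp [h, hx]

theorem MemLp.mul_of_bounded {c : Pt → ℝ} {C : ℝ} (hf : MemLp f 2 (volume.restrict s))
    (hc : AEStronglyMeasurable c (volume.restrict s)) (hC : ∀ᵐ x ∂volume.restrict s, |c x| ≤ C) :
    MemLp (fun x => c x * f x) 2 (volume.restrict s) :=
  hf.of_le_mul (c := C) (hc.mul hf.aestronglyMeasurable) (hC.mono fun x hx => by
    rw [norm_mul, Real.norm_eq_abs]; gcongr)

/-! ### Horizontal slabs -/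

/-- The slab `ℝ² × (a, b)`. -/
def slab (a b : ℝ) : Set Pt := {x | a < x.2 ∧ x.2 < b}

theorem isOpen_slab (a b : ℝ) : IsOpen (slab a b) := isOpen_Ioo.preimage continuous_snd

theorem measurableSet_slab (a b : ℝ) : MeasurableSet (slab a b) := (isOpen_slab a b).measurableSet

theorem restrict_slab (a b : ℝ) : (volume : Measure Pt).restrict (slab a b)
    = (volume : Measure Hor).prod (volume.restrict (Ioo a b)) := by
  have : slab a b = univ ×ˢ Ioo a b := by ext x; simp [slab]
  rw [this, Measure.volume_eq_prod, ← Measure.prod_restrict, Measure.restrict_univ]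

theorem e_snd_of_ne_two {i : Fin 3} (hi : i ≠ 2) : (e i).2 = 0 := by
  fin_cases i
  · simp [e]
  · simp [e]
  · exact absurd rfl hi

theorem e_two_snd : (e 2).2 = 1 := by simp [e]

variable {a b : ℝ} {i : Fin 3} {f' g' : Pt → ℝ}

theorem hasFDerivAt_comp_snd {χ : ℝ → ℝ} (hχ : ContDiff ℝ ∞ χ) (x : Pt) :
    HasFDerivAt (fun x : Pt => χ x.2) (deriv χ x.2 • ContinuousLinearMap.snd ℝ Hor ℝ) x :=
  ((hχ.differentiable (by simp) x.2).hasDerivAt).comp_hasFDerivAt x hasFDerivAt_snd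

theorem fderiv_cutoff_mul {χ : ℝ → ℝ} (hχ : ContDiff ℝ ∞ χ) {φ : Pt → ℝ} (hφ : ContDiff ℝ ∞ φ)
    (x w : Pt) : fderiv ℝ (fun x : Pt => χ x.2 * φ x) x w
      = χ x.2 * fderiv ℝ φ x w + deriv χ x.2 * w.2 * φ x := by
  rw [((hasFDerivAt_comp_snd hχ x).fun_mul (hφ.differentiable (by simp) x).hasFDerivAt).fderiv]
  simp
  ring

theorem tsupport_cutoff_mul {χ : ℝ → ℝ} (hχ : tsupport χ ⊆ Ioo a b) (φ : Pt → ℝ) :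
    tsupport (fun x : Pt => χ x.2 * φ x) ⊆ slab a b := by
  refine (tsupport_mul_subset_left (f := fun x : Pt => χ x.2) (g := φ)).trans ?_
  refine (tsupport_comp_subset_preimage χ continuous_snd).trans fun x hx => ?_
  exact hχ hx

theorem memLp_cutoff_mul {χ : ℝ → ℝ} (hχ : Continuous χ) (hχc : HasCompactSupport χ)
    (hf : MemLp f 2 (volume.restrict s)) :
    MemLp (fun x => χ x.2 * f x) 2 (volume.restrict s) := by
  obtain ⟨M, hM⟩ := hχc.exists_bound_of_continuous hχ
  exact MemLp.mul_of_bounded hf (hχ.comp continuous_snd).aestronglyMeasurable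
    (ae_of_all _ fun x => hM _)

theorem memLp_cutoff_deriv (hf : HasWeakPartial (slab a b) i f f') {χ : ℝ → ℝ}
    (hχ : ContDiff ℝ ∞ χ) (hχc : HasCompactSupport χ) :
    MemLp (fun x => deriv χ x.2 * f x * (e i).2 + χ x.2 * f' x) 2 (volume.restrict (slab a b)) := by
  have h1 := (memLp_cutoff_mul (hχ.continuous_deriv (by simp)) hχc.deriv hf.memLp_fun).const_mul
    (e i).2
  refine (h1.add (memLp_cutoff_mul hχ.continuous hχc hf.memLp_deriv)).ae_eq (ae_of_all _ fun x => ?_)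
  simp only [Pi.add_apply]
  ring

/-- A test function on `ℝ³` becomes admissible in the slab after multiplication by `χ(x₃)`. The
derivative that falls on `χ` contributes only when the direction is vertical, hence the factor `(e
i).2`. -/
theorem isWeakDeriv_cutoff (hf : HasWeakPartial (slab a b) i f f') {χ : ℝ → ℝ}
    (hχ : ContDiff ℝ ∞ χ) (hχc : HasCompactSupport χ) (hχs : tsupport χ ⊆ Ioo a b) :
    IsWeakDeriv (e i) (extendZero (slab a b) fun x => χ x.2 * f x)
      (extendZero (slab a b) fun x => deriv χ x.2 * f x * (e i).2 + χ x.2 * f' x) := by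
  intro φ h1 h2
  have hs := measurableSet_slab a b
  have hm := memLp_cutoff_mul hχ.continuous hχc hf.memLp_fun
  have hm' := memLp_cutoff_mul hχ.continuous hχc hf.memLp_deriv
  have hd := memLp_cutoff_mul (hχ.continuous_deriv (by simp)) hχc.deriv hf.memLp_fun
  rw [integral_extendZero_mul hs hm, integral_extendZero_mul hs (memLp_cutoff_deriv hf hχ hχc)]
  have hφ2 : MemLp φ 2 (volume.restrict (slab a b)) :=
    (memLp_of_test h1.continuous h2).restrict _
  have hdφ2 : MemLp (fun x => fderiv ℝ φ x (e i)) 2 (volume.restrict (slab a b)) :=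
    (memLp_of_test ((h1.continuous_fderiv (by simp)).clm_apply continuous_const)
      (h2.fderiv_apply ℝ (e i))).restrict _
  have key := hf.integral_eq (fun x => χ x.2 * φ x) ((hχ.comp contDiff_snd).mul h1)
    h2.mul_left (tsupport_cutoff_mul hχs φ)
  have e1 : ∀ x, f x * fderiv ℝ (fun x : Pt => χ x.2 * φ x) x (e i)
      = χ x.2 * f x * fderiv ℝ φ x (e i) + (e i).2 * (deriv χ x.2 * f x * φ x) := fun x => by
    rw [fderiv_cutoff_mul hχ h1]; ring
  have e2 : ∀ x, (deriv χ x.2 * f x * (e i).2 + χ x.2 * f' x) * φ x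
      = (e i).2 * (deriv χ x.2 * f x * φ x) + χ x.2 * f' x * φ x := fun x => by ring
  have e3 : ∀ x, f' x * (χ x.2 * φ x) = χ x.2 * f' x * φ x := fun x => by ring
  have i1 : Integrable (fun x => χ x.2 * f x * fderiv ℝ φ x (e i)) (volume.restrict (slab a b)) :=
    hm.integrable_mul (q := 2) hdφ2
  have i2 : Integrable (fun x => (e i).2 * (deriv χ x.2 * f x * φ x)) (volume.restrict (slab a b)) :=
    (hd.integrable_mul (q := 2) hφ2).const_mul _
  have i3 : Integrable (fun x => χ x.2 * f' x * φ x) (volume.restrict (slab a b)) :=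
    hm'.integrable_mul (q := 2) hφ2
  simp only [e1, e3] at key
  simp only [e2]
  rw [integral_add i1 i2] at key
  rw [integral_add i2 i3]
  linarith

/-- The product rule, tested against functions of `x₃`. -/
theorem integral_product_rule (hf : HasWeakPartial (slab a b) i f f')
    (hg : HasWeakPartial (slab a b) i g g') {χ : ℝ → ℝ}
    (hχ : ContDiff ℝ ∞ χ) (hχc : HasCompactSupport χ) (hχs : tsupport χ ⊆ Ioo a b) :
    ∫ x in slab a b, (f x * g x * (deriv χ x.2 * (e i).2) + (f' x * g x + f x * g' x) * χ x.2)
      = 0 := by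
  -- A second cutoff equal to `1` on the support of `χ` makes both `χ f` and `ψ g` differentiable on
  -- all of `ℝ³`, while their product is still `χ f g`.
  obtain ⟨ψ, hψ, hψc, hψs, hψ1, -⟩ := exists_cutoff hχc.isCompact isOpen_Ioo hχs
  have hs := measurableSet_slab a b
  have hmul : ∀ z, χ z * ψ z = χ z := fun z => by
    by_cases hz : z ∈ tsupport χ
    · rw [hψ1 z hz, mul_one]
    · rw [image_eq_zero_of_notMem_tsupport hz, zero_mul]
  have hmul' : ∀ z, deriv χ z * ψ z + χ z * deriv ψ z = deriv χ z := fun z => by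
    have h1 := ((hχ.differentiable (by simp) z).hasDerivAt.mul
      (hψ.differentiable (by simp) z).hasDerivAt)
    rw [← h1.deriv]
    congr 1
    exact funext hmul
  have h := inner_add_inner_eq_zero_of_hasDerivAt
    (isWeakDeriv_cutoff hf hχ hχc hχs).hasDerivAt (isWeakDeriv_cutoff hg hψ hψc hψs).hasDerivAt
  have m1 := memLp_cutoff_mul hχ.continuous hχc hf.memLp_fun
  have m2 := memLp_cutoff_mul hψ.continuous hψc hg.memLp_fun
  have m3 := memLp_cutoff_deriv hf hχ hχc
  have m4 := memLp_cutoff_deriv hg hψ hψc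
  have i1 : Integrable (fun x => (deriv χ x.2 * f x * (e i).2 + χ x.2 * f' x) * (ψ x.2 * g x))
      (volume.restrict (slab a b)) := m3.integrable_mul (q := 2) m2
  have i2 : Integrable (fun x => χ x.2 * f x * (deriv ψ x.2 * g x * (e i).2 + ψ x.2 * g' x))
      (volume.restrict (slab a b)) := m1.integrable_mul (q := 2) m4
  rw [inner_extendZero hs m3 m2, inner_extendZero hs m1 m4, ← integral_add i1 i2] at h
  rw [← h]
  refine integral_congr_ae (ae_of_all _ fun x => ?_)
  simp only
  linear_combination (-(f x * g x * (e i).2)) * hmul' x.2 - (f' x * g x + f x * g' x) * hmul x.2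

/-! ### Slices and the flux through horizontal planes -/

theorem ae_memLp_slice (hf : MemLp f 2 (volume.restrict (slab a b))) :
    ∀ᵐ z, z ∈ Ioo a b → MemLp (fun x' : Hor => f (x', z)) 2 volume := by
  rw [restrict_slab] at hf
  rw [← ae_restrict_iff' measurableSet_Ioo]
  filter_upwards [hf.integrable_sq.prod_left_ae, hf.aestronglyMeasurable.prodMk_right] with z h1 h2
  exact (memLp_two_iff_integrable_sq h2).2 h1

theorem integral_slab {h : Pt → ℝ} (hh : IntegrableOn h (slab a b)) :
    IntegrableOn (fun z => ∫ x' : Hor, h (x', z)) (Ioo a b) ∧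
      ∫ x in slab a b, h x = ∫ z in Ioo a b, ∫ x' : Hor, h (x', z) := by
  rw [IntegrableOn, restrict_slab] at hh
  refine ⟨hh.integral_prod_right, ?_⟩
  rw [restrict_slab]
  exact integral_prod_symm _ hh

/-- The integral of `f g` over the horizontal planes has one-sided limits at the two faces of a
slab, whose difference is the integral of `f' g + f g'`. -/
theorem exists_tendsto_flux (hab : a < b) (hf : HasWeakPartial (slab a b) 2 f f')
    (hg : HasWeakPartial (slab a b) 2 g g') :
    ∃ c, Tendsto (fun z => ∫ x' : Hor, f (x', z) * g (x', z)) (𝓝[>] a ⊓ ae volume) (𝓝 c) ∧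
      Tendsto (fun z => ∫ x' : Hor, f (x', z) * g (x', z)) (𝓝[<] b ⊓ ae volume)
        (𝓝 (c + ∫ x in slab a b, (f' x * g x + f x * g' x))) := by
  have i1 : IntegrableOn (fun x => f x * g x) (slab a b) :=
    hf.memLp_fun.integrable_mul (q := 2) hg.memLp_fun
  have i2 : IntegrableOn (fun x => f' x * g x + f x * g' x) (slab a b) :=
    (hf.memLp_deriv.integrable_mul (q := 2) hg.memLp_fun).add
      (hf.memLp_fun.integrable_mul (q := 2) hg.memLp_deriv)
  rw [(integral_slab i2).2]
  -- By Fubini, the product rule tested against functions of `x₃` alone says that the flux has the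
  -- slice integrals of `f' g + f g'` as weak derivative.
  refine exists_tendsto_of_weak_deriv hab (integral_slab i1).1 (integral_slab i2).1
    fun χ h1 h2 h3 => ?_
  have hb : ∀ {h : Pt → ℝ}, IntegrableOn h (slab a b) → ∀ {ψ : ℝ → ℝ}, Continuous ψ →
      HasCompactSupport ψ → IntegrableOn (fun x => h x * ψ x.2) (slab a b) := by
    intro h hh ψ hψ hψc
    obtain ⟨M, hM⟩ := hψc.exists_bound_of_continuous hψ
    exact hh.mul_bdd (c := M) (hψ.comp continuous_snd).aestronglyMeasurable
      (ae_of_all _ fun x => hM _)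
  have hd : Continuous (deriv χ) := h1.continuous_deriv (by simp)
  have key := integral_product_rule hf hg h1 h2 h3
  simp only [e_two_snd, mul_one] at key
  rw [integral_add (hb i1 hd h2.deriv) (hb i2 h1.continuous h2),
    (integral_slab (hb i1 hd h2.deriv)).2, (integral_slab (hb i2 h1.continuous h2)).2] at key
  simp only [integral_mul_const] at key
  linarith

theorem exists_lp_curve_of_trace {F : Filter ℝ} {w : Hor → ℝ} (h : HasTrace F f w)
    (hm : ∀ᶠ z in F ⊓ ae volume, MemLp (fun x' : Hor => f (x', z)) 2 volume) :
    ∃ u : ℝ → Lp ℝ 2 (volume : Measure Hor),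
      (∀ᶠ z in F ⊓ ae volume, u z =ᵐ[volume] fun x' : Hor => f (x', z)) ∧
      Tendsto u (F ⊓ ae volume) (𝓝 (h.1.toLp w)) := by
  classical
  refine ⟨fun z => if hz : MemLp (fun x' : Hor => f (x', z)) 2 volume then hz.toLp _ else 0,
    ?_, ?_⟩
  · filter_upwards [hm] with z hz
    rw [dif_pos hz]
    exact hz.coeFn_toLp
  · rw [tendsto_iff_edist_tendsto_0]
    refine h.2.congr' ?_
    filter_upwards [hm] with z hz
    rw [dif_pos hz, Lp.edist_toLp_toLp]
    rfl

theorem integral_mul_eq_inner {u v : Lp ℝ 2 (volume : Measure Hor)} {f g : Hor → ℝ}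
    (hu : u =ᵐ[volume] f) (hv : v =ᵐ[volume] g) : ∫ x, f x * g x = inner ℝ u v := by
  rw [MeasureTheory.L2.inner_def]
  refine integral_congr_ae ?_
  filter_upwards [hu, hv] with x h1 h2
  simp [h1, h2, mul_comm]

theorem tendsto_flux_of_trace {F : Filter ℝ} {w w' : Hor → ℝ} (hf : HasTrace F f w)
    (hg : HasTrace F g w')
    (hfm : ∀ᶠ z in F ⊓ ae volume, MemLp (fun x' : Hor => f (x', z)) 2 volume)
    (hgm : ∀ᶠ z in F ⊓ ae volume, MemLp (fun x' : Hor => g (x', z)) 2 volume) :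
    Tendsto (fun z => ∫ x' : Hor, f (x', z) * g (x', z)) (F ⊓ ae volume)
      (𝓝 (∫ x', w x' * w' x')) := by
  obtain ⟨u, hu, hut⟩ := exists_lp_curve_of_trace hf hfm
  obtain ⟨v, hv, hvt⟩ := exists_lp_curve_of_trace hg hgm
  rw [integral_mul_eq_inner hf.1.coeFn_toLp hg.1.coeFn_toLp]
  refine (hut.inner hvt).congr' ?_
  filter_upwards [hu, hv] with z h1 h2
  exact (integral_mul_eq_inner h1 h2).symm

/-- The flux of `f g` tends to zero at a face where `f` has square integrals with a finite limit
and `g` has zero trace. -/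
theorem tendsto_flux_of_zero_trace {F : Filter ℝ} {c : ℝ} (hg : HasTrace F g 0)
    (hf : Tendsto (fun z => ∫ x' : Hor, f (x', z) * f (x', z)) (F ⊓ ae volume) (𝓝 c))
    (hfm : ∀ᶠ z in F ⊓ ae volume, MemLp (fun x' : Hor => f (x', z)) 2 volume)
    (hgm : ∀ᶠ z in F ⊓ ae volume, MemLp (fun x' : Hor => g (x', z)) 2 volume) :
    Tendsto (fun z => ∫ x' : Hor, f (x', z) * g (x', z)) (F ⊓ ae volume) (𝓝 0) := by
  have h1 := hf.mul (tendsto_flux_of_trace hg hg hgm hgm)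
  simp only [Pi.zero_apply, mul_zero, integral_zero] at h1
  -- The flux is at most this square root by the Cauchy–Schwarz inequality on the slice.
  have h2 : Tendsto (fun z => √((∫ x' : Hor, f (x', z) * f (x', z))
      * ∫ x' : Hor, g (x', z) * g (x', z))) (F ⊓ ae volume) (𝓝 0) := by
    simpa [Function.comp_def] using (Real.continuous_sqrt.tendsto 0).comp h1
  refine squeeze_zero_norm' ?_ h2
  filter_upwards [hfm, hgm] with z h3 h4
  rw [integral_mul_eq_inner h3.coeFn_toLp h4.coeFn_toLp,
    integral_mul_eq_inner h3.coeFn_toLp h3.coeFn_toLp,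
    integral_mul_eq_inner h4.coeFn_toLp h4.coeFn_toLp, real_inner_self_eq_norm_sq,
    real_inner_self_eq_norm_sq, ← mul_pow, Real.sqrt_sq (by positivity)]
  exact norm_inner_le_norm _ _

/-- Integration by parts in the vertical direction over two adjacent slabs, for functions without
jump at the interface, one of which vanishes at the outer faces. -/
theorem integral_vertical_parts {l m : ℝ} (hl : 0 < l) (hm : 0 < m)
    (hfu : HasWeakPartial (slab 0 l) 2 f f') (hfl : HasWeakPartial (slab (-m) 0) 2 f f')
    (hgu : HasWeakPartial (slab 0 l) 2 g g') (hgl : HasWeakPartial (slab (-m) 0) 2 g g')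
    (hf : NoJump f) (hg : NoJump g) (htop : HasTrace (𝓝[<] l) g 0)
    (hbot : HasTrace (𝓝[>] (-m)) g 0) :
    (∫ x in slab 0 l, (f' x * g x + f x * g' x))
      + ∫ x in slab (-m) 0, (f' x * g x + f x * g' x) = 0 := by
  obtain ⟨fp, fm, hfp, hfm, hfj⟩ := hf
  obtain ⟨gp, gm, hgp, hgm, hgj⟩ := hg
  have hm' : -m < 0 := by linarith
  have hgt : ∀ {a b : ℝ} {h : Pt → ℝ}, a < b → MemLp h 2 (volume.restrict (slab a b)) →
      ∀ᶠ z in 𝓝[>] a ⊓ ae volume, MemLp (fun x' : Hor => h (x', z)) 2 volume := by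
    intro a b h hab hh
    filter_upwards [mem_inf_of_left (Ioo_mem_nhdsGT hab), mem_inf_of_right (ae_memLp_slice hh)]
      with z h1 h2 using h2 h1
  have hlt : ∀ {a b : ℝ} {h : Pt → ℝ}, a < b → MemLp h 2 (volume.restrict (slab a b)) →
      ∀ᶠ z in 𝓝[<] b ⊓ ae volume, MemLp (fun x' : Hor => h (x', z)) 2 volume := by
    intro a b h hab hh
    filter_upwards [mem_inf_of_left (Ioo_mem_nhdsLT hab), mem_inf_of_right (ae_memLp_slice hh)]
      with z h1 h2 using h2 h1
  obtain ⟨cu, hu1, hu2⟩ := exists_tendsto_flux hl hfu hgu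
  obtain ⟨cl, hl1, hl2⟩ := exists_tendsto_flux hm' hfl hgl
  -- No trace of `f` is assumed at the outer faces. Its flux against itself has a limit there, which
  -- is enough next to the zero trace of `g`.
  obtain ⟨_, -, hff⟩ := exists_tendsto_flux hl hfu hfu
  obtain ⟨_, hff', -⟩ := exists_tendsto_flux hm' hfl hfl
  have t1 := tendsto_nhds_unique hu1
    (tendsto_flux_of_trace hfp hgp (hgt hl hfu.1) (hgt hl hgu.1))
  have t2 := tendsto_nhds_unique hl2
    (tendsto_flux_of_trace hfm hgm (hlt hm' hfl.1) (hlt hm' hgl.1))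
  have t3 := tendsto_nhds_unique hu2
    (tendsto_flux_of_zero_trace htop hff (hlt hl hfu.1) (hlt hl hgu.1))
  have t4 := tendsto_nhds_unique hl1
    (tendsto_flux_of_zero_trace hbot hff' (hgt hm' hfl.1) (hgt hm' hgl.1))
  have t5 : ∫ x', fp x' * gp x' = ∫ x', fm x' * gm x' := by
    refine integral_congr_ae ?_
    filter_upwards [hfj, hgj] with x h1 h2
    simp only [Pi.sub_apply, Pi.zero_apply, sub_eq_zero] at h1 h2
    rw [h1, h2]
  linarith

/-! ### Horizontal translations and derivatives in slabs -/

theorem hasWeakPartial_translate (hf : HasWeakPartial (slab a b) i f f') {w : Pt} (hw : w.2 = 0) :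
    HasWeakPartial (slab a b) i (fun x => f (x + w)) (fun x => f' (x + w)) := by
  have hpre : (fun x : Pt => x + w) ⁻¹' slab a b = slab a b := by
    ext x; simp [slab, hw]
  have hmp : MeasurePreserving (fun x : Pt => x + w) (volume.restrict (slab a b))
      (volume.restrict (slab a b)) := by
    have := (measurePreserving_add_right (volume : Measure Pt) w).restrict_preimage
      (measurableSet_slab a b)
    rwa [hpre] at this
  have hemb : MeasurableEmbedding fun x : Pt => x + w := measurableEmbedding_addRight w
  refine ⟨hf.memLp_fun.comp_measurePreserving hmp, hf.memLp_deriv.comp_measurePreserving hmp,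
    fun φ h1 h2 h3 => ?_⟩
  have hts : tsupport (fun x => φ (x - w)) ⊆ slab a b := by
    refine (tsupport_comp_subset_preimage φ (by fun_prop)).trans fun x hx => ?_
    have := h3 hx
    simpa [slab, hw] using this
  have key := hf.integral_eq (fun x => φ (x - w)) (h1.comp (by fun_prop))
    (h2.comp_homeomorph (Homeomorph.subRight w)) hts
  have l1 := hmp.integral_comp hemb fun x => f x * fderiv ℝ φ (x - w) (e i)
  have l2 := hmp.integral_comp hemb fun x => f' x * φ (x - w)
  simp only [add_sub_cancel_right] at l1 l2
  simp only [fderiv_comp_sub] at key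
  rw [l1, l2, key]

theorem hasTrace_translate {F : Filter ℝ} {u : Hor → ℝ} (hf : HasTrace F f u) {w : Pt}
    (hw : w.2 = 0) : HasTrace F (fun x => f (x + w)) (fun x' => u (x' + w.1)) := by
  have hmp : MeasurePreserving (fun x : Hor => x + w.1) volume volume :=
    measurePreserving_add_right _ _
  have hemb : MeasurableEmbedding fun x : Hor => x + w.1 := measurableEmbedding_addRight w.1
  refine ⟨hf.1.comp_measurePreserving hmp, hf.2.congr fun z => ?_⟩
  have h2 := hemb.eLpNorm_map_measure (μ := volume) (p := 2)
    (g := fun x' : Hor => f (x', z) - u x')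
  rw [hmp.map_eq] at h2
  rw [h2]
  congr 1
  funext x'
  simp only [Function.comp_apply]
  congr 2
  exact Prod.ext rfl (by simp [hw])

theorem noJump_translate (hf : NoJump f) {w : Pt} (hw : w.2 = 0) :
    NoJump fun x => f (x + w) := by
  obtain ⟨fp, fm, h1, h2, h3⟩ := hf
  refine ⟨_, _, hasTrace_translate h1 hw, hasTrace_translate h2 hw, ?_⟩
  have := (measurePreserving_add_right (volume : Measure Hor) w.1).quasiMeasurePreserving.ae h3
  filter_upwards [this] with x hx
  exact hx

/-- A horizontal weak derivative in a slab is one of the extensions by zero. -/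
theorem isWeakDeriv_of_horizontal (hf : HasWeakPartial (slab a b) i f f') (hi : i ≠ 2) :
    IsWeakDeriv (e i) (extendZero (slab a b) f) (extendZero (slab a b) f') := by
  intro φ h1 h2
  have hs := measurableSet_slab a b
  rw [integral_extendZero_mul hs hf.memLp_fun, integral_extendZero_mul hs hf.memLp_deriv]
  -- Vertical cutoffs exhausting the slab are invisible to a horizontal derivative, so the limit
  -- produces no term at the faces.
  have hK : ∀ n : ℕ, Icc (a + 1 / (n + 1 : ℝ)) (b - 1 / (n + 1 : ℝ)) ⊆ Ioo a b := fun n =>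
    Icc_subset_Ioo (by have : (0 : ℝ) < 1 / (n + 1 : ℝ) := by positivity
                       linarith) (by have : (0 : ℝ) < 1 / (n + 1 : ℝ) := by positivity
                                     linarith)
  choose χ hχ hχc hχs hχ1 hχb using fun n => exists_cutoff isCompact_Icc isOpen_Ioo (hK n)
  have hlim : ∀ z ∈ Ioo a b, Tendsto (fun n => χ n z) atTop (𝓝 1) := fun z hz => by
    refine tendsto_const_nhds.congr' ?_
    have h0 := tendsto_one_div_add_atTop_nhds_zero_nat (𝕜 := ℝ)
    filter_upwards [h0.eventually_lt_const (sub_pos.2 hz.1),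
      h0.eventually_lt_const (sub_pos.2 hz.2)] with n h3 h4
    exact (hχ1 n z ⟨by linarith, by linarith⟩).symm
  have hdct : ∀ {h ψ : Pt → ℝ}, MemLp h 2 (volume.restrict (slab a b)) → Continuous ψ →
      HasCompactSupport ψ → Tendsto (fun n => ∫ x in slab a b, h x * (χ n x.2 * ψ x)) atTop
        (𝓝 (∫ x in slab a b, h x * ψ x)) := by
    intro h ψ hh hψ hψc
    have hint : Integrable (fun x => h x * ψ x) (volume.restrict (slab a b)) :=
      hh.integrable_mul (q := 2) ((memLp_of_test hψ hψc).restrict _)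
    refine tendsto_integral_of_dominated_convergence (fun x => ‖h x * ψ x‖) (fun n => ?_)
      hint.norm (fun n => ae_of_all _ fun x => ?_) ?_
    · exact hh.aestronglyMeasurable.mul
        ((((hχ n).continuous.comp continuous_snd).mul hψ).aestronglyMeasurable)
    · rw [norm_mul, norm_mul, norm_mul]
      gcongr
      exact mul_le_of_le_one_left (norm_nonneg _) (hχb n _)
    · filter_upwards [ae_restrict_mem hs] with x hx
      have := ((hlim x.2 hx).mul_const (ψ x)).const_mul (h x)
      rwa [one_mul] at this
  have hd : Continuous fun x => fderiv ℝ φ x (e i) :=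
    (h1.continuous_fderiv (by simp)).clm_apply continuous_const
  refine tendsto_nhds_unique (hdct hf.memLp_fun hd (h2.fderiv_apply ℝ (e i))) ?_
  refine (hdct hf.memLp_deriv h1.continuous h2).neg.congr fun n => ?_
  rw [← hf.integral_eq (fun x => χ n x.2 * φ x) (((hχ n).comp contDiff_snd).mul h1)
    h2.mul_left (tsupport_cutoff_mul (hχs n) φ)]
  simp only [fderiv_cutoff_mul (hχ n) h1, e_snd_of_ne_two hi, mul_zero, zero_mul, add_zero]

/-! ### Multiplication by functions of `x₃` -/

/-- A measurable function with values in `[c, C]`. -/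
structure IsCoefficient (ρ : ℝ → ℝ) (c C : ℝ) : Prop where
  measurable : Measurable ρ
  pos : 0 < c
  lower : ∀ z, c ≤ ρ z
  upper : ∀ z, ρ z ≤ C

namespace IsCoefficient

variable {ρ σ : ℝ → ℝ} {c C c' C' : ℝ} (hρ : IsCoefficient ρ c C)

theorem abs_le (hρ : IsCoefficient ρ c C) (z : ℝ) : |ρ z| ≤ C :=
  _root_.abs_le.2 ⟨by linarith [hρ.pos, hρ.lower z, hρ.upper z], hρ.upper z⟩

theorem memLp_mul (hρ : IsCoefficient ρ c C) {f : Pt → ℝ} {μ : Measure Pt} (hf : MemLp f 2 μ) :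
    MemLp (fun x => ρ x.2 * f x) 2 μ :=
  hf.of_le_mul (c := C)
    ((hρ.measurable.comp measurable_snd).aestronglyMeasurable.mul hf.aestronglyMeasurable)
    (ae_of_all _ fun x => by
      rw [norm_mul, Real.norm_eq_abs]
      gcongr
      exact hρ.abs_le _)

/-- Multiplication by `ρ(x₃)` on `L²(ℝ³)`. -/
def mul : L2 →L[ℝ] L2 :=
  LinearMap.mkContinuous
    { toFun := fun f => (hρ.memLp_mul (Lp.memLp f)).toLp _
      map_add' := fun f g => by
        rw [← MemLp.toLp_add]
        refine MemLp.toLp_congr _ _ ?_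
        filter_upwards [Lp.coeFn_add f g] with x hx
        simp only [hx, Pi.add_apply, mul_add]
      map_smul' := fun r f => by
        rw [RingHom.id_apply, ← MemLp.toLp_const_smul]
        refine MemLp.toLp_congr _ _ ?_
        filter_upwards [Lp.coeFn_smul r f] with x hx
        simp only [hx, Pi.smul_apply, smul_eq_mul]
        ring }
    C fun f => by
      refine Lp.norm_le_mul_norm_of_ae_le_mul ?_
      filter_upwards [(hρ.memLp_mul (Lp.memLp f)).coeFn_toLp] with x hx
      simp only [LinearMap.coe_mk, AddHom.coe_mk, hx]
      rw [norm_mul, Real.norm_eq_abs]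
      gcongr
      exact hρ.abs_le _

theorem coeFn_mul (f : L2) : hρ.mul f =ᵐ[volume] fun x => ρ x.2 * f x :=
  (hρ.memLp_mul (Lp.memLp f)).coeFn_toLp

theorem inner_mul (f g : L2) : inner ℝ (hρ.mul f) g = inner ℝ f (hρ.mul g) := by
  rw [L2.inner_eq, L2.inner_eq]
  refine integral_congr_ae ?_
  filter_upwards [hρ.coeFn_mul f, hρ.coeFn_mul g] with x h1 h2
  rw [h1, h2]
  ring

theorem mul_translate {w : Pt} (hw : w.2 = 0) (f : L2) :
    hρ.mul (translate w f) = translate w (hρ.mul f) := by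
  refine Lp.ext ?_
  filter_upwards [hρ.coeFn_mul (translate w f), coeFn_translate w f,
    coeFn_translate w (hρ.mul f), ae_comp_add_right w (hρ.coeFn_mul f)] with x h1 h2 h3 h4
  rw [h1, h2, h3, h4, Prod.snd_add, hw, add_zero]

theorem le_inner_mul (f : L2) : c * ‖f‖ ^ 2 ≤ inner ℝ (hρ.mul f) f := by
  rw [← real_inner_self_eq_norm_sq, L2.inner_eq, L2.inner_eq, ← integral_const_mul]
  refine integral_mono_ae ?_ ?_ ?_
  · exact ((Lp.memLp f).integrable_mul (q := 2) (Lp.memLp f)).const_mul c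
  · exact (Lp.memLp (hρ.mul f)).integrable_mul (q := 2) (Lp.memLp f)
  · filter_upwards [hρ.coeFn_mul f] with x hx
    simp only [hx, mul_assoc]
    exact mul_le_mul_of_nonneg_right (hρ.lower _) (mul_self_nonneg _)

theorem mul_mul_eq {hσ : IsCoefficient σ c' C'} {τ : ℝ → ℝ} {d d' : ℝ} {hτ : IsCoefficient τ d d'}
    (h : ∀ z, σ z * ρ z = τ z) (f : L2) : hσ.mul (hρ.mul f) = hτ.mul f := by
  refine Lp.ext ?_
  filter_upwards [hσ.coeFn_mul (hρ.mul f), hρ.coeFn_mul f, hτ.coeFn_mul f] with x h1 h2 h3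
  rw [h1, h2, h3, ← mul_assoc, h]

theorem div (hρ : IsCoefficient ρ c C) (hσ : IsCoefficient σ c' C') :
    IsCoefficient (fun z => σ z / ρ z) (c' / C) (C' / c) where
  measurable := hσ.measurable.div hρ.measurable
  pos := div_pos hσ.pos (hρ.pos.trans_le ((hρ.lower 0).trans (hρ.upper 0)))
  lower z := div_le_div₀ (hσ.pos.le.trans (hσ.lower z)) (hσ.lower z)
    (hρ.pos.trans_le (hρ.lower z)) (hρ.upper z)
  upper z := div_le_div₀ (hσ.pos.le.trans ((hσ.lower z).trans (hσ.upper z))) (hσ.upper z)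
    hρ.pos (hρ.lower z)

theorem one : IsCoefficient (fun _ => 1) 1 1 := ⟨measurable_const, one_pos, fun _ => le_rfl,
  fun _ => le_rfl⟩

theorem one_mul (f : L2) : one.mul f = f := by
  refine Lp.ext ?_
  filter_upwards [one.coeFn_mul f] with x hx
  rw [hx, _root_.one_mul]

end IsCoefficient

/-! ### Bounds for the coefficients of the equations -/

theorem PressureLaw.exists_deriv_bounds {p : ℝ → ℝ} (hp : PressureLaw p) {a b : ℝ} (ha : 0 < a) :
    ∃ c C, 0 < c ∧ ∀ z ∈ Icc a b, c ≤ deriv p z ∧ deriv p z ≤ C := by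
  have hsub : Icc a b ⊆ Ioi 0 := fun z hz => ha.trans_le hz.1
  obtain ⟨M, hM⟩ := hp.inv_deriv_bounded _ isCompact_Icc hsub
  have hcont : ContinuousOn (deriv p) (Ioi 0) :=
    hp.smooth.continuousOn_deriv_of_isOpen isOpen_Ioi (by simp)
  obtain ⟨C, hC⟩ := isCompact_Icc.exists_bound_of_continuousOn (hcont.mono hsub)
  -- The bound `M` carries no sign information, whereas `|M| + 1` is positive; monotonicity gives
  -- `p' ≥ 0`, so `1 ≤ M p'` implies `1 ≤ (|M| + 1) p'`.
  refine ⟨1 / (|M| + 1), C, by positivity, fun z hz => ⟨?_, (le_abs_self _).trans (hC z hz)⟩⟩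
  have h0 : 0 ≤ deriv p z := by
    rw [← derivWithin_of_isOpen isOpen_Ioi (hsub hz)]
    exact hp.strictMono.monotoneOn.derivWithin_nonneg
  rw [div_le_iff₀ (by positivity)]
  have h1 := hM z hz
  nlinarith [le_abs_self M, mul_le_mul_of_nonneg_right (le_abs_self M) h0]

theorem exists_measurable_extension {A B : Set ℝ} (hA : MeasurableSet A) (hB : MeasurableSet B)
    {h : ℝ → ℝ} (hcA : ContinuousOn h A) (hcB : ContinuousOn h B) :
    ∃ k : ℝ → ℝ, Measurable k ∧ (∀ z ∈ A ∪ B, k z = h z) ∧ ∀ z ∉ A ∪ B, k z = 1 := by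
  classical
  have mA : Measurable (A.piecewise h fun _ => 0) :=
    hcA.measurable_piecewise continuousOn_const hA
  have mB : Measurable (B.piecewise h fun _ => 1) :=
    hcB.measurable_piecewise continuousOn_const hB
  refine ⟨A.piecewise (A.piecewise h fun _ => 0) (B.piecewise h fun _ => 1), mA.piecewise hA mB,
    fun z hz => ?_, fun z hz => ?_⟩
  · by_cases hzA : z ∈ A
    · simp [hzA]
    · have hzB : z ∈ B := hz.resolve_left hzA
      simp [hzA, hzB]
  · rw [mem_union, not_or] at hz
    simp [hz.1, hz.2]

variable {D : Data}

theorem Data.mem_domain_iff {x : Pt} :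
    x ∈ D.domain ↔ x.2 ∈ Ioo 0 D.l ∪ Ioo (-D.m) 0 := Iff.rfl

/-- The density and `p'(ρ₀)` are controlled only inside the two layers, while multiplication
operators on `L²(ℝ³)` need bounds at every height. Extending by the value `1` is harmless, because
the functions multiplied vanish outside the domain. -/
theorem Data.Admissible.exists_coefficients (hD : D.Admissible) :
    ∃ (ρ π : ℝ → ℝ) (c C : ℝ), IsCoefficient ρ c C ∧ IsCoefficient π c C ∧
      (∀ x ∈ D.domain, ρ x.2 = D.ρ₀ x.2) ∧ ∀ x ∈ D.domain, π x.2 = D.dp x.2 := by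
  obtain ⟨a, b, ha, hab⟩ := hD.density_bounds
  have hl := hD.l_pos
  have hm := hD.m_pos
  have hu : Ioo 0 D.l ⊆ Ioo (-D.m) D.l := Ioo_subset_Ioo_left (by linarith)
  have hw : Ioo (-D.m) 0 ⊆ Ioo (-D.m) D.l := Ioo_subset_Ioo_right (by linarith)
  obtain ⟨cu, Cu, hcu, hu'⟩ := hD.pressureUp.exists_deriv_bounds (b := b) ha
  obtain ⟨cw, Cw, hcw, hw'⟩ := hD.pressureLow.exists_deriv_bounds (b := b) ha
  have hdp : ∀ {p : ℝ → ℝ}, PressureLaw p → ContinuousOn (deriv p) (Ioi 0) := fun hp =>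
    hp.smooth.continuousOn_deriv_of_isOpen isOpen_Ioi (by simp)
  obtain ⟨ρ, hρ, hρ1, hρ2⟩ := exists_measurable_extension measurableSet_Ioo measurableSet_Ioo
    hD.smooth_up.continuousOn hD.smooth_low.continuousOn
  have edu : ∀ z ∈ Ioo 0 D.l, D.dp z = deriv D.pUp (D.ρ₀ z) := fun z hz => by
    rw [Data.dp, if_pos hz.1]
  have edw : ∀ z ∈ Ioo (-D.m) 0, D.dp z = deriv D.pLow (D.ρ₀ z) := fun z hz => by
    rw [Data.dp, if_neg (not_lt.2 hz.2.le)]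
  obtain ⟨π, hπ, hπ1, hπ2⟩ := exists_measurable_extension (h := D.dp) (A := Ioo 0 D.l)
    (B := Ioo (-D.m) 0) measurableSet_Ioo measurableSet_Ioo
    (((hdp hD.pressureUp).comp hD.smooth_up.continuousOn
      fun z hz => ha.trans_le (hab z (hu hz)).1).congr edu)
    (((hdp hD.pressureLow).comp hD.smooth_low.continuousOn
      fun z hz => ha.trans_le (hab z (hw hz)).1).congr edw)
  refine ⟨ρ, π, min (min a 1) (min cu cw), max (max b 1) (max Cu Cw),
    ⟨hρ, by positivity, fun z => ?_, fun z => ?_⟩, ⟨hπ, by positivity, fun z => ?_, fun z => ?_⟩,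
    fun x hx => hρ1 _ hx, fun x hx => hπ1 _ hx⟩
  · by_cases hz : z ∈ Ioo 0 D.l ∪ Ioo (-D.m) 0
    · rw [hρ1 z hz]
      exact ((min_le_left _ _).trans (min_le_left _ _)).trans
        (hab z (hz.elim (fun h => hu h) fun h => hw h)).1
    · rw [hρ2 z hz]
      exact (min_le_left _ _).trans (min_le_right _ _)
  · by_cases hz : z ∈ Ioo 0 D.l ∪ Ioo (-D.m) 0
    · rw [hρ1 z hz]
      exact (hab z (hz.elim (fun h => hu h) fun h => hw h)).2.trans
        ((le_max_left _ _).trans (le_max_left _ _))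
    · rw [hρ2 z hz]
      exact (le_max_right _ _).trans (le_max_left _ _)
  · by_cases hz : z ∈ Ioo 0 D.l ∪ Ioo (-D.m) 0
    · rw [hπ1 z hz]
      rcases hz with hz | hz
      · rw [edu z hz]
        exact ((min_le_right _ _).trans (min_le_left _ _)).trans (hu' _ (hab z (hu hz))).1
      · rw [edw z hz]
        exact ((min_le_right _ _).trans (min_le_right _ _)).trans (hw' _ (hab z (hw hz))).1
    · rw [hπ2 z hz]
      exact (min_le_left _ _).trans (min_le_right _ _)
  · by_cases hz : z ∈ Ioo 0 D.l ∪ Ioo (-D.m) 0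
    · rw [hπ1 z hz]
      rcases hz with hz | hz
      · rw [edu z hz]
        exact (hu' _ (hab z (hu hz))).2.trans ((le_max_left _ _).trans (le_max_right _ _))
      · rw [edw z hz]
        exact (hw' _ (hab z (hw hz))).2.trans ((le_max_right _ _).trans (le_max_right _ _))
    · rw [hπ2 z hz]
      exact (le_max_right _ _).trans (le_max_left _ _)

/-! ### States of the linearized system in `L²(ℝ³)` -/

/-- `Φ` is a test function supported in `Ω₊` or in `Ω₋`, and `Φ'` is its gradient. -/
def IsTest (D : Data) (Φ : L2) (Φ' : Fin 3 → L2) : Prop :=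
  ∃ φ : Pt → ℝ, ContDiff ℝ ∞ φ ∧ HasCompactSupport φ ∧
    (tsupport φ ⊆ D.upper ∨ tsupport φ ⊆ D.lower) ∧ Φ =ᵐ[volume] φ ∧
    ∀ j, Φ' j =ᵐ[volume] fun x => fderiv ℝ φ x (e j)

/-- The equations at one instant, apart from the jump and boundary conditions, for functions
extended by zero: `v'`, `P`, `Q`, `G`, `F₀`, `F₁` stand for `∂ₜ v`, `∇(p'(ρ₀) q)`, `(∂ᵢ vᵢ)ᵢ`, `∇η₃`,
`∂₁η₁` and `∂₂η₂`. -/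
structure StateAt (D : Data) (R : L2 →L[ℝ] L2) (η v : ℝ → Fin 3 → L2) (q : ℝ → L2) (t : ℝ)
    (v' P Q G : Fin 3 → L2) (F₀ F₁ : L2) : Prop where
  deriv_η : ∀ i, HasDerivAt (fun s => η s i) (v t i) t
  deriv_v : ∀ i, HasDerivAt (fun s => v s i) (v' i) t
  deriv_q : HasDerivAt q (-R (∑ i, Q i)) t
  momentum_zero : R (v' 0) = -P 0 - D.g • R (G 0) + (2 * D.angVel) • R (v t 1)
  momentum_one : R (v' 1) = -P 1 - D.g • R (G 1) - (2 * D.angVel) • R (v t 0)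
  momentum_two : R (v' 2) = -P 2 - D.g • q t - D.g • R (G 2)
  orbit_G_zero : HasDerivAt (fun s : ℝ => translate (s • e 0) (η t 2)) (G 0) 0
  orbit_G_one : HasDerivAt (fun s : ℝ => translate (s • e 1) (η t 2)) (G 1) 0
  orbit_F_zero : HasDerivAt (fun s : ℝ => translate (s • e 0) (η t 0)) F₀ 0
  orbit_F_one : HasDerivAt (fun s : ℝ => translate (s • e 1) (η t 1)) F₁ 0
  weak_η : ∀ Φ Φ', IsTest D Φ Φ' → ∑ j, inner ℝ (η t j) (Φ' j) = -inner ℝ (F₀ + F₁ + G 2) Φ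
  weak_v : ∀ Φ Φ', IsTest D Φ Φ' → ∑ j, inner ℝ (v t j) (Φ' j) = -inner ℝ (∑ j, Q j) Φ
  support : ∀ᵐ x, x ∉ D.domain → q t x = 0 ∧ (F₀ + F₁ + G 2 : L2) x = 0

variable {D : Data} {R : L2 →L[ℝ] L2}

theorem StateAt.sub {η₁ v₁ η₂ v₂ : ℝ → Fin 3 → L2} {q₁ q₂ : ℝ → L2} {t : ℝ}
    {v₁' P₁ Q₁ G₁ v₂' P₂ Q₂ G₂ : Fin 3 → L2} {F₀₁ F₁₁ F₀₂ F₁₂ : L2}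
    (h₁ : StateAt D R η₁ v₁ q₁ t v₁' P₁ Q₁ G₁ F₀₁ F₁₁)
    (h₂ : StateAt D R η₂ v₂ q₂ t v₂' P₂ Q₂ G₂ F₀₂ F₁₂) :
    StateAt D R (fun s i => η₁ s i - η₂ s i) (fun s i => v₁ s i - v₂ s i) (fun s => q₁ s - q₂ s) t
      (fun i => v₁' i - v₂' i) (fun i => P₁ i - P₂ i) (fun i => Q₁ i - Q₂ i)
      (fun i => G₁ i - G₂ i) (F₀₁ - F₀₂) (F₁₁ - F₁₂) where
  deriv_η i := (h₁.deriv_η i).sub (h₂.deriv_η i)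
  deriv_v i := (h₁.deriv_v i).sub (h₂.deriv_v i)
  deriv_q := (h₁.deriv_q.sub h₂.deriv_q).congr_deriv (by
    rw [Finset.sum_sub_distrib, map_sub]; abel)
  momentum_zero := by
    simp only [map_sub, h₁.momentum_zero, h₂.momentum_zero, smul_sub]; abel
  momentum_one := by
    simp only [map_sub, h₁.momentum_one, h₂.momentum_one, smul_sub]; abel
  momentum_two := by
    simp only [map_sub, h₁.momentum_two, h₂.momentum_two, smul_sub]; abel
  orbit_G_zero := by simpa only [map_sub] using h₁.orbit_G_zero.fun_sub h₂.orbit_G_zero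
  orbit_G_one := by simpa only [map_sub] using h₁.orbit_G_one.fun_sub h₂.orbit_G_one
  orbit_F_zero := by simpa only [map_sub] using h₁.orbit_F_zero.fun_sub h₂.orbit_F_zero
  orbit_F_one := by simpa only [map_sub] using h₁.orbit_F_one.fun_sub h₂.orbit_F_one
  weak_η Φ Φ' hΦ := by
    have e1 : F₀₁ - F₀₂ + (F₁₁ - F₁₂) + (G₁ 2 - G₂ 2)
        = (F₀₁ + F₁₁ + G₁ 2) - (F₀₂ + F₁₂ + G₂ 2) := by abel
    simp only [e1, inner_sub_left, Finset.sum_sub_distrib, h₁.weak_η Φ Φ' hΦ, h₂.weak_η Φ Φ' hΦ]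
    ring
  weak_v Φ Φ' hΦ := by
    simp only [inner_sub_left, Finset.sum_sub_distrib, h₁.weak_v Φ Φ' hΦ, h₂.weak_v Φ Φ' hΦ]
    ring
  support := by
    have e1 : F₀₁ - F₀₂ + (F₁₁ - F₁₂) + (G₁ 2 - G₂ 2)
        = (F₀₁ + F₁₁ + G₁ 2) - (F₀₂ + F₁₂ + G₂ 2) := by abel
    rw [e1]
    filter_upwards [h₁.support, h₂.support, Lp.coeFn_sub (q₁ t) (q₂ t),
      Lp.coeFn_sub (F₀₁ + F₁₁ + G₁ 2) (F₀₂ + F₁₂ + G₂ 2)] with x a1 a2 a3 a4 hx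
    rw [a3, a4, Pi.sub_apply, Pi.sub_apply, (a1 hx).1, (a1 hx).2, (a2 hx).1, (a2 hx).2, sub_zero]
    exact ⟨rfl, rfl⟩

theorem exists_isTest {φ : Pt → ℝ} (h1 : ContDiff ℝ ∞ φ) (h2 : HasCompactSupport φ)
    (h3 : tsupport φ ⊆ D.upper ∨ tsupport φ ⊆ D.lower) :
    ∃ Φ Φ', IsTest D Φ Φ' ∧ Φ =ᵐ[volume] φ := by
  have hd : ∀ j, MemLp (fun x => fderiv ℝ φ x (e j)) 2 volume := fun j =>
    memLp_of_test ((h1.continuous_fderiv (by simp)).clm_apply continuous_const)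
      (h2.fderiv_apply ℝ (e j))
  have hm := memLp_of_test h1.continuous h2
  exact ⟨hm.toLp φ, fun j => (hd j).toLp _, ⟨φ, h1, h2, h3, hm.coeFn_toLp,
    fun j => (hd j).coeFn_toLp⟩, hm.coeFn_toLp⟩

theorem isOpen_upper : IsOpen D.upper := isOpen_slab 0 D.l

theorem isOpen_lower : IsOpen D.lower := isOpen_slab (-D.m) 0

theorem measurableSet_domain : MeasurableSet D.domain :=
  (isOpen_upper.union isOpen_lower).measurableSet

theorem eq_zero_of_inner_test {Z : L2} (h : ∀ Φ Φ', IsTest D Φ Φ' → inner ℝ Z Φ = 0)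
    (hs : ∀ᵐ x, x ∉ D.domain → Z x = 0) : Z = 0 := by
  have key : ∀ {O : Set Pt}, IsOpen O → O ⊆ D.upper ∨ O ⊆ D.lower → ∀ᵐ x, x ∈ O → Z x = 0 := by
    intro O hO hOD
    refine hO.ae_eq_zero_of_integral_contDiff_smul_eq_zero
      ((L2.locallyIntegrable Z).locallyIntegrableOn O) fun φ h1 h2 h3 => ?_
    obtain ⟨Φ, Φ', hΦ, hφ⟩ := exists_isTest (D := D) h1 h2
      (hOD.imp (fun h => h3.trans h) fun h => h3.trans h)
    rw [← h Φ Φ' hΦ, L2.inner_eq]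
    refine integral_congr_ae ?_
    filter_upwards [hφ] with x hx
    rw [hx, smul_eq_mul, mul_comm]
  refine Lp.ext ?_
  filter_upwards [key isOpen_upper (.inl subset_rfl), key isOpen_lower (.inr subset_rfl), hs,
    Lp.coeFn_zero ℝ 2 (volume : Measure Pt)] with x h1 h2 h3 h4
  rw [h4, Pi.zero_apply]
  by_cases hx : x ∈ D.domain
  · exact hx.elim h1 h2
  · exact h3 hx

/-- A solution with zero initial data satisfies `q + ρ₀ div η = 0`. -/
theorem add_div_eq_zero {ρ : ℝ → ℝ} {c C : ℝ} (hρ : IsCoefficient ρ c C)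
    {η v : ℝ → Fin 3 → L2} {q : ℝ → L2} {b : ℝ}
    (hη : ∀ i, ContinuousOn (fun s => η s i) (Icc 0 b)) (hq : ContinuousOn q (Icc 0 b))
    (hη0 : ∀ i, η 0 i = 0) (hq0 : q 0 = 0)
    (hst : ∀ t ∈ Ioo 0 b, ∃ v' P Q G F₀ F₁, StateAt D hρ.mul η v q t v' P Q G F₀ F₁)
    {t : ℝ} (ht : t ∈ Ioo 0 b) {v' P Q G : Fin 3 → L2} {F₀ F₁ : L2}
    (h : StateAt D hρ.mul η v q t v' P Q G F₀ F₁) :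
    hρ.mul (G 2) = -q t - hρ.mul F₀ - hρ.mul F₁ := by
  have hJ := hρ.div IsCoefficient.one
  have hJR : ∀ f, hJ.mul (hρ.mul f) = f := fun f => by
    rw [hρ.mul_mul_eq (hτ := IsCoefficient.one), IsCoefficient.one_mul]
    intro z
    exact div_mul_cancel₀ _ (hρ.pos.trans_le (hρ.lower z)).ne'
  have hRJ : ∀ f, hρ.mul (hJ.mul f) = f := fun f => by
    rw [hJ.mul_mul_eq (hτ := IsCoefficient.one), IsCoefficient.one_mul]
    intro z
    exact mul_div_cancel₀ _ (hρ.pos.trans_le (hρ.lower z)).ne'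
  -- Dividing by `ρ₀` before testing puts the constraint in the form `ρ₀⁻¹ q + div η = 0`, in which
  -- the divergence can be moved onto the test function.
  have key : hJ.mul (q t) + (F₀ + F₁ + G 2) = 0 := by
    refine eq_zero_of_inner_test (D := D) (fun Φ Φ' hΦ => ?_) ?_
    -- No regularity in time is available for `div η` itself, so the constraint is paired with a
    -- fixed test function. The pairing is continuous up to time `0`, vanishes there, and has zero
    -- derivative afterwards.
    · let Θ : ℝ → ℝ := fun s => inner ℝ (hJ.mul (q s)) Φ - ∑ j, inner ℝ (η s j) (Φ' j)
      have hΘc : ContinuousOn Θ (Icc 0 b) :=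
        ((hJ.mul.continuous.comp_continuousOn hq).inner continuousOn_const).sub
          (continuousOn_finsetSum _ fun j _ => (hη j).inner continuousOn_const)
      have hΘd : ∀ s ∈ Ioo 0 b, HasDerivAt Θ 0 s := by
        intro s hs
        obtain ⟨v', P, Q, G, F₀, F₁, h'⟩ := hst s hs
        have d1 := (hJ.mul.hasFDerivAt.comp_hasDerivAt s h'.deriv_q).inner ℝ (hasDerivAt_const s Φ)
        have d2 := HasDerivAt.fun_sum fun j (_ : j ∈ Finset.univ) =>
          (h'.deriv_η j).inner ℝ (hasDerivAt_const s (Φ' j))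
        refine (d1.sub d2).congr_deriv ?_
        simp only [inner_zero_right, zero_add, map_neg, hJR, h'.weak_v Φ Φ' hΦ, inner_neg_left,
          sub_self]
      have hΘ0 : Θ 0 = 0 := by simp [Θ, hη0, hq0]
      obtain ⟨s, hs, hs'⟩ := exists_hasDerivAt_eq_slope Θ (fun _ => 0) ht.1
        (hΘc.mono (Icc_subset_Icc_right ht.2.le)) fun s hs => hΘd s ⟨hs.1, hs.2.trans ht.2⟩
      rw [hΘ0, sub_zero, sub_zero, eq_comm, div_eq_zero_iff] at hs'
      have hΘt : inner ℝ (hJ.mul (q t)) Φ - ∑ j, inner ℝ (η t j) (Φ' j) = 0 :=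
        hs'.resolve_right ht.1.ne'
      rw [inner_add_left]
      linarith [h.weak_η Φ Φ' hΦ]
    · filter_upwards [h.support, hJ.coeFn_mul (q t),
        Lp.coeFn_add (hJ.mul (q t)) (F₀ + F₁ + G 2)] with x h1 h2 h3 hx
      rw [h3, Pi.add_apply, h2, (h1 hx).1, (h1 hx).2]
      ring
  have := congrArg hρ.mul key
  rw [_root_.map_add, hRJ, map_zero, _root_.map_add, _root_.map_add] at this
  rw [← sub_eq_zero, ← this]
  abel

/-! ### From solutions to states -/

/-- `F` is the extension by zero of `f|_Ω`. -/
def Represents (D : Data) (F : L2) (f : Pt → ℝ) : Prop := F =ᵐ[volume] D.domain.indicator f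

namespace Represents

variable {F G : L2} {f g : Pt → ℝ}

theorem of_memLp (hf : MemLp f 2 (volume.restrict D.domain)) :
    Represents D (extendZero D.domain f) f := coeFn_extendZero measurableSet_domain hf

theorem add (hF : Represents D F f) (hG : Represents D G g) :
    Represents D (F + G) fun x => f x + g x := by
  filter_upwards [hF, hG, Lp.coeFn_add F G] with x h1 h2 h3
  rw [h3, Pi.add_apply, h1, h2]
  by_cases hx : x ∈ D.domain <;> simp [hx]

theorem neg (hF : Represents D F f) : Represents D (-F) fun x => -f x := by
  filter_upwards [hF, Lp.coeFn_neg F] with x h1 h3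
  rw [h3, Pi.neg_apply, h1]
  by_cases hx : x ∈ D.domain <;> simp [hx]

theorem sub (hF : Represents D F f) (hG : Represents D G g) :
    Represents D (F - G) fun x => f x - g x := by
  filter_upwards [hF, hG, Lp.coeFn_sub F G] with x h1 h2 h3
  rw [h3, Pi.sub_apply, h1, h2]
  by_cases hx : x ∈ D.domain <;> simp [hx]

theorem smul (r : ℝ) (hF : Represents D F f) : Represents D (r • F) fun x => r * f x := by
  filter_upwards [hF, Lp.coeFn_smul r F] with x h1 h3
  by_cases hx : x ∈ D.domain <;> simp [hx, h1, h3]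

theorem mul {ρ σ : ℝ → ℝ} {c C : ℝ} (hρ : IsCoefficient ρ c C)
    (h : ∀ x ∈ D.domain, ρ x.2 = σ x.2) (hF : Represents D F f) :
    Represents D (hρ.mul F) fun x => σ x.2 * f x := by
  filter_upwards [hF, hρ.coeFn_mul F] with x h1 h3
  by_cases hx : x ∈ D.domain <;> simp [hx, h1, h3, h]

theorem eq (hF : Represents D F f) (hG : Represents D G g)
    (h : ∀ᵐ x ∂volume.restrict D.domain, f x = g x) : F = G := by
  rw [ae_restrict_iff' measurableSet_domain] at h
  refine Lp.ext ?_
  filter_upwards [hF, hG, h] with x h1 h2 h3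
  rw [h1, h2]
  by_cases hx : x ∈ D.domain <;> simp [hx, h3]

theorem eq_zero (hF : Represents D F f) : ∀ᵐ x, x ∉ D.domain → F x = 0 := by
  filter_upwards [hF] with x h1 hx
  rw [h1, indicator_of_notMem hx]

theorem ae_eq (hF : Represents D F f) (hG : Represents D F g) :
    f =ᵐ[volume.restrict D.domain] g := by
  rw [EventuallyEq, ae_restrict_iff' measurableSet_domain]
  filter_upwards [hF, hG] with x h1 h2 hx
  rw [h1] at h2
  simpa [hx] using h2

end Represents

theorem disjoint_upper_lower : Disjoint D.upper D.lower :=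
  Set.disjoint_left.2 fun _ h1 h2 => lt_asymm h1.1 h2.2

theorem indicator_domain (f : Pt → ℝ) :
    D.domain.indicator f = D.upper.indicator f + D.lower.indicator f :=
  indicator_union_of_disjoint disjoint_upper_lower f

theorem memLp_domain {f : Pt → ℝ} (hu : MemLp f 2 (volume.restrict D.upper))
    (hl : MemLp f 2 (volume.restrict D.lower)) : MemLp f 2 (volume.restrict D.domain) := by
  rw [← memLp_indicator_iff_restrict measurableSet_domain, indicator_domain]
  exact (memLp_indicator isOpen_upper.measurableSet hu).add
    (memLp_indicator isOpen_lower.measurableSet hl)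

theorem extendZero_domain {f : Pt → ℝ} (hu : MemLp f 2 (volume.restrict D.upper))
    (hl : MemLp f 2 (volume.restrict D.lower)) :
    extendZero D.domain f = extendZero D.upper f + extendZero D.lower f := by
  refine Lp.ext ?_
  filter_upwards [coeFn_extendZero measurableSet_domain (memLp_domain hu hl),
    coeFn_extendZero isOpen_upper.measurableSet hu, coeFn_extendZero isOpen_lower.measurableSet hl,
    Lp.coeFn_add (extendZero D.upper f) (extendZero D.lower f)] with x h1 h2 h3 h4
  rw [h4, Pi.add_apply, h1, h2, h3, indicator_domain, Pi.add_apply]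

theorem setIntegral_domain {h : Pt → ℝ} (hh : IntegrableOn h D.domain) :
    ∫ x in D.domain, h x = (∫ x in D.upper, h x) + ∫ x in D.lower, h x :=
  setIntegral_union disjoint_upper_lower isOpen_lower.measurableSet
    (hh.mono_set subset_union_left) (hh.mono_set subset_union_right)

variable {f f' g g' : Pt → ℝ} {i : Fin 3}

theorem Data.HasPartial.memLp (h : D.HasPartial i f f') : MemLp f 2 (volume.restrict D.domain) :=
  memLp_domain h.1.memLp_fun h.2.memLp_fun

theorem Data.HasPartial.memLp_deriv (h : D.HasPartial i f f') :
    MemLp f' 2 (volume.restrict D.domain) :=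
  memLp_domain h.1.memLp_deriv h.2.memLp_deriv

theorem Data.HasPartial.hasDerivAt_orbit (h : D.HasPartial i f f') (hi : i ≠ 2) :
    HasDerivAt (fun s : ℝ => translate (s • e i) (extendZero D.domain f))
      (extendZero D.domain f') 0 := by
  rw [extendZero_domain h.1.memLp_fun h.2.memLp_fun,
    extendZero_domain h.1.memLp_deriv h.2.memLp_deriv]
  simp only [_root_.map_add]
  exact (isWeakDeriv_of_horizontal (a := 0) (b := D.l) h.1 hi).hasDerivAt.fun_add
    (isWeakDeriv_of_horizontal (a := -D.m) (b := 0) h.2 hi).hasDerivAt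

theorem Data.HasPartial.inner_test (h : D.HasPartial i f f') {Φ : L2} {Φ' : Fin 3 → L2}
    (hΦ : IsTest D Φ Φ') :
    inner ℝ (extendZero D.domain f) (Φ' i) = -inner ℝ (extendZero D.domain f') Φ := by
  obtain ⟨φ, h1, h2, h3, h4, h5⟩ := hΦ
  have e1 : inner ℝ (extendZero D.domain f) (Φ' i)
      = ∫ x in D.domain, f x * fderiv ℝ φ x (e i) := by
    rw [L2.inner_eq, ← integral_extendZero_mul measurableSet_domain h.memLp]
    refine integral_congr_ae ?_
    filter_upwards [h5 i] with x hx
    rw [hx]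
  have e2 : inner ℝ (extendZero D.domain f') Φ = ∫ x in D.domain, f' x * φ x := by
    rw [L2.inner_eq, ← integral_extendZero_mul measurableSet_domain h.memLp_deriv]
    refine integral_congr_ae ?_
    filter_upwards [h4] with x hx
    rw [hx]
  have hz : ∀ x, x ∉ tsupport φ → fderiv ℝ φ x (e i) = 0 := fun x hx => by
    rw [image_eq_zero_of_notMem_tsupport fun h' => hx (tsupport_fderiv_subset ℝ h')]
    rfl
  have hmono : ∀ {s : Set Pt}, MeasurableSet s → s ⊆ D.domain → tsupport φ ⊆ s →
      (∫ x in D.domain, f x * fderiv ℝ φ x (e i)) = (∫ x in s, f x * fderiv ℝ φ x (e i)) ∧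
      ∫ x in D.domain, f' x * φ x = ∫ x in s, f' x * φ x := by
    intro s hs hsD hφs
    constructor
    · exact setIntegral_eq_of_subset_of_forall_sdiff_eq_zero measurableSet_domain hsD
        fun x hx => by rw [hz x fun h' => hx.2 (hφs h'), mul_zero]
    · exact setIntegral_eq_of_subset_of_forall_sdiff_eq_zero measurableSet_domain hsD
        fun x hx => by rw [image_eq_zero_of_notMem_tsupport fun h' => hx.2 (hφs h'), mul_zero]
  rw [e1, e2]
  rcases h3 with h3 | h3
  · obtain ⟨a1, a2⟩ := hmono isOpen_upper.measurableSet subset_union_left h3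
    rw [a1, a2]
    exact h.1.integral_eq φ h1 h2 h3
  · obtain ⟨a1, a2⟩ := hmono isOpen_lower.measurableSet subset_union_right h3
    rw [a1, a2]
    exact h.2.integral_eq φ h1 h2 h3

theorem HasWeakPartial.congr {U : Set Pt} (hU : MeasurableSet U) (h : HasWeakPartial U i f f')
    (hg : ∀ x ∈ U, f' x = g' x) : HasWeakPartial U i f g' := by
  have hae : f' =ᵐ[volume.restrict U] g' := by
    filter_upwards [ae_restrict_mem hU] with x hx using hg x hx
  refine ⟨h.memLp_fun, h.memLp_deriv.ae_eq hae, fun φ h1 h2 h3 => ?_⟩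
  rw [h.integral_eq φ h1 h2 h3]
  congr 1
  refine integral_congr_ae ?_
  filter_upwards [hae] with x hx
  rw [hx]

theorem Data.PiecewiseH1.exists_hasPartial (h : D.PiecewiseH1 f) (i : Fin 3) :
    ∃ f', D.HasPartial i f f' := by
  classical
  obtain ⟨fu, hu⟩ := h.1.2 i
  obtain ⟨fl, hl⟩ := h.2.2 i
  refine ⟨D.upper.piecewise fu fl, hu.congr isOpen_upper.measurableSet fun x hx => ?_,
    hl.congr isOpen_lower.measurableSet fun x hx => ?_⟩
  · rw [piecewise_eq_of_mem _ _ _ hx]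
  · rw [piecewise_eq_of_notMem _ _ _ fun h' => disjoint_upper_lower.ne_of_mem h' hx rfl]

theorem edist_extendZero {s : Set Pt} (hs : MeasurableSet s) (hf : MemLp f 2 (volume.restrict s))
    (hg : MemLp g 2 (volume.restrict s)) :
    edist (extendZero s f) (extendZero s g)
      = eLpNorm (fun x => f x - g x) 2 (volume.restrict s) := by
  rw [extendZero, dif_pos (memLp_indicator hs hf), extendZero, dif_pos (memLp_indicator hs hg),
    Lp.edist_toLp_toLp, ← indicator_sub', eLpNorm_indicator_eq_eLpNorm_restrict hs]
  rfl

theorem continuousOn_extendZero {U : Set Pt} (hU : MeasurableSet U) {f : ℝ → Pt → ℝ} {I : Set ℝ}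
    (h : L2ContinuousOn U f I) : ContinuousOn (fun t => extendZero U (f t)) I := by
  intro t ht
  rw [ContinuousWithinAt, tendsto_iff_edist_tendsto_0]
  refine (h.2 t ht).congr' ?_
  filter_upwards [self_mem_nhdsWithin] with s hs
  exact (edist_extendZero hU (h.1 s hs) (h.1 t ht)).symm

theorem hasDerivAt_extendZero {U : Set Pt} (hU : MeasurableSet U) {f : ℝ → Pt → ℝ} {t : ℝ}
    (h : HasL2Deriv U f f' t) (hm : ∀ᶠ s in 𝓝 t, MemLp (f s) 2 (volume.restrict U)) :
    HasDerivAt (fun s => extendZero U (f s)) (extendZero U f') t := by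
  rw [hasDerivAt_iff_tendsto_slope, tendsto_iff_edist_tendsto_0]
  refine h.2.congr' ?_
  have ht := hm.self_of_nhds
  filter_upwards [nhdsWithin_le_nhds hm] with s hs
  have hq : MemLp (fun x => (s - t)⁻¹ * (f s x - f t x)) 2 (volume.restrict U) :=
    (hs.sub ht).const_mul _
  rw [← edist_extendZero hU hq h.1]
  congr 1
  refine Lp.ext ?_
  rw [slope_def_module]
  filter_upwards [coeFn_extendZero hU hq, coeFn_extendZero hU hs, coeFn_extendZero hU ht,
    Lp.coeFn_smul (s - t)⁻¹ (extendZero U (f s) - extendZero U (f t)),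
    Lp.coeFn_sub (extendZero U (f s)) (extendZero U (f t))] with x h1 h2 h3 h4 h5
  rw [h4, Pi.smul_apply, h5, Pi.sub_apply, h1, h2, h3]
  by_cases hx : x ∈ U <;> simp [hx]

/-! ### Green's identity under the jump and boundary conditions -/

namespace TranslatesOrthogonal

variable {x₁ x₂ y₁ y₂ z₁ z₂ : L2}

theorem sub_right (h : TranslatesOrthogonal x₁ x₂ y₁ y₂) (h' : TranslatesOrthogonal x₁ x₂ z₁ z₂) :
    TranslatesOrthogonal x₁ x₂ (y₁ - z₁) (y₂ - z₂) := by
  intro w hw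
  rw [map_sub, map_sub, inner_sub_right, inner_sub_right]
  linarith [h w hw, h' w hw]

theorem sub_left (h : TranslatesOrthogonal y₁ y₂ x₁ x₂) (h' : TranslatesOrthogonal z₁ z₂ x₁ x₂) :
    TranslatesOrthogonal (y₁ - z₁) (y₂ - z₂) x₁ x₂ := (h.symm.sub_right h'.symm).symm

end TranslatesOrthogonal

variable {D : Data} {f f' g g' : Pt → ℝ}

theorem Data.HasPartial.translate {i : Fin 3} (h : D.HasPartial i f f') {w : Pt} (hw : w.2 = 0) :
    D.HasPartial i (fun x => f (x + w)) fun x => f' (x + w) :=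
  ⟨hasWeakPartial_translate (a := 0) (b := D.l) h.1 hw,
    hasWeakPartial_translate (a := -D.m) (b := 0) h.2 hw⟩

theorem translate_extendZero (hf : MemLp f 2 (volume.restrict D.domain)) {w : Pt} (hw : w.2 = 0)
    (hfw : MemLp (fun x => f (x + w)) 2 (volume.restrict D.domain)) :
    translate w (extendZero D.domain f) = extendZero D.domain fun x => f (x + w) := by
  refine Lp.ext ?_
  filter_upwards [coeFn_translate w (extendZero D.domain f),
    ae_comp_add_right w (coeFn_extendZero measurableSet_domain hf),
    coeFn_extendZero measurableSet_domain hfw] with x h1 h2 h3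
  rw [h1, h2, h3]
  have hiff : x + w ∈ D.domain ↔ x ∈ D.domain := by
    rw [Data.mem_domain_iff, Data.mem_domain_iff, Prod.snd_add, hw, add_zero]
  by_cases hx : x ∈ D.domain
  · rw [indicator_of_mem hx, indicator_of_mem (hiff.2 hx)]
  · rw [indicator_of_notMem hx, indicator_of_notMem fun h => hx (hiff.1 h)]

/-- Vertical integration by parts under the jump and boundary conditions. -/
theorem translatesOrthogonal_vertical (hl : 0 < D.l) (hm : 0 < D.m)
    (hf : D.HasPartial 2 f f') (hg : D.HasPartial 2 g g') (hfj : NoJump f) (hgj : NoJump g)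
    (htop : HasTrace (𝓝[<] D.l) g 0) (hbot : HasTrace (𝓝[>] (-D.m)) g 0) :
    TranslatesOrthogonal (extendZero D.domain f') (extendZero D.domain f)
      (extendZero D.domain g) (extendZero D.domain g') := by
  intro w hw
  -- Horizontal translation preserves the layers and all the trace conditions, so the vertical
  -- integration by parts applies to the translate of `g`.
  have hgw := hg.translate hw
  rw [translate_extendZero hg.memLp hw hgw.memLp,
    translate_extendZero hg.memLp_deriv hw hgw.memLp_deriv,
    inner_extendZero measurableSet_domain hf.memLp_deriv hgw.memLp,
    inner_extendZero measurableSet_domain hf.memLp hgw.memLp_deriv]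
  have i1 : Integrable (fun x => f' x * g (x + w)) (volume.restrict D.domain) :=
    hf.memLp_deriv.integrable_mul (q := 2) hgw.memLp
  have i2 : Integrable (fun x => f x * g' (x + w)) (volume.restrict D.domain) :=
    hf.memLp.integrable_mul (q := 2) hgw.memLp_deriv
  have i3 : IntegrableOn (fun x => f' x * g (x + w) + f x * g' (x + w)) D.domain := i1.add i2
  rw [← integral_add i1 i2, setIntegral_domain i3]
  exact integral_vertical_parts hl hm hf.1 hf.2 hgw.1 hgw.2 hfj (noJump_translate hgj hw)
    (hasTrace_translate htop hw) (hasTrace_translate hbot hw)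

/-- Horizontal directions need no boundary information, since extension by zero keeps horizontal
weak derivatives. The trace conditions, which concern the third component only, enter when `i = 2`.
-/
theorem translatesOrthogonal_partial (hl : 0 < D.l) (hm : 0 < D.m) (i : Fin 3) {V : Fin 3 → Pt → ℝ}
    (hf : D.HasPartial i f f') (hg : D.HasPartial i (V i) g') (hfj : NoJump f)
    (hgj : NoJump (V 2)) (htop : HasTrace (𝓝[<] D.l) (V 2) 0)
    (hbot : HasTrace (𝓝[>] (-D.m)) (V 2) 0) :
    TranslatesOrthogonal (extendZero D.domain f') (extendZero D.domain f)
      (extendZero D.domain (V i)) (extendZero D.domain g') := by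
  by_cases hi : i = 2
  · subst hi
    exact translatesOrthogonal_vertical hl hm hf hg hfj hgj htop hbot
  · exact translatesOrthogonal_of_hasDerivAt (hf.hasDerivAt_orbit hi) (hg.hasDerivAt_orbit hi)

section Solutions

variable {T : EReal} {η v : ℝ → Pt → EuclideanSpace ℝ (Fin 3)} {q : ℝ → Pt → ℝ}

/-- The partial derivatives `P` and `Q` are also returned as functions on the layers, because
Green's identity uses traces, which the `L²(ℝ³)` formulation no longer sees. -/
theorem Data.IsSolution.exists_stateAt (h : D.IsSolution T η v q) {ρ : ℝ → ℝ} {c C : ℝ}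
    (hρ : IsCoefficient ρ c C) (hρD : ∀ x ∈ D.domain, ρ x.2 = D.ρ₀ x.2) {t : ℝ} (ht : 0 < t)
    (htT : (t : EReal) < T) :
    ∃ (v' P Q G : Fin 3 → Pt → ℝ) (F₀ F₁ : Pt → ℝ),
      (∀ i, D.HasPartial i (fun x => D.dp x.2 * q t x) (P i)) ∧
      (∀ i, D.HasPartial i (fun x => v t x i) (Q i)) ∧
      StateAt D hρ.mul (fun s i => extendZero D.domain fun x => η s x i)
        (fun s i => extendZero D.domain fun x => v s x i) (fun s => extendZero D.domain (q s)) t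
        (fun i => extendZero D.domain (v' i)) (fun i => extendZero D.domain (P i))
        (fun i => extendZero D.domain (Q i)) (fun i => extendZero D.domain (G i))
        (extendZero D.domain F₀) (extendZero D.domain F₁) := by
  obtain ⟨qt, Q, hqt, hQ, hmass⟩ := h.mass t ht htT
  obtain ⟨v', P, G, hv', hP, hG, hmom⟩ := h.momentum t ht htT
  obtain ⟨F₀, hF₀⟩ := (h.sobolev_η t ht htT 0).exists_hasPartial 0
  obtain ⟨F₁, hF₁⟩ := (h.sobolev_η t ht htT 1).exists_hasPartial 1
  have hev : ∀ᶠ s in 𝓝 t, s ∈ {s : ℝ | 0 ≤ s ∧ (s : EReal) < T} := by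
    filter_upwards [lt_mem_nhds ht,
      (continuous_coe_real_ereal.tendsto t).eventually_lt_const htT] with s h1 h2 using ⟨h1.le, h2⟩
  have htm : t ∈ {s : ℝ | 0 ≤ s ∧ (s : EReal) < T} := ⟨ht.le, htT⟩
  have rv : ∀ i, Represents D (extendZero D.domain fun x => v t x i) fun x => v t x i := fun i =>
    .of_memLp ((h.continuous_v i).1 t htm)
  have rq : Represents D (extendZero D.domain (q t)) (q t) := .of_memLp (h.continuous_q.1 t htm)
  have rv' : ∀ i, Represents D (extendZero D.domain (v' i)) (v' i) := fun i => .of_memLp (hv' i).1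
  have rP : ∀ i, Represents D (extendZero D.domain (P i)) (P i) := fun i =>
    .of_memLp (hP i).memLp_deriv
  have rQ : ∀ i, Represents D (extendZero D.domain (Q i)) (Q i) := fun i =>
    .of_memLp (hQ i).memLp_deriv
  have rG : ∀ i, Represents D (extendZero D.domain (G i)) (G i) := fun i =>
    .of_memLp (hG i).memLp_deriv
  have rF₀ : Represents D (extendZero D.domain F₀) F₀ := .of_memLp hF₀.memLp_deriv
  have rF₁ : Represents D (extendZero D.domain F₁) F₁ := .of_memLp hF₁.memLp_deriv
  have rF := (rF₀.add rF₁).add (rG 2)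
  refine ⟨v', P, Q, G, F₀, F₁, hP, hQ, ?_⟩
  exact
    { deriv_η := fun i => hasDerivAt_extendZero measurableSet_domain (h.flow t ht htT i)
        (hev.mono fun s hs => (h.continuous_η i).1 s hs)
      deriv_v := fun i => hasDerivAt_extendZero measurableSet_domain (hv' i)
        (hev.mono fun s hs => (h.continuous_v i).1 s hs)
      deriv_q := by
        refine (hasDerivAt_extendZero measurableSet_domain hqt
          (hev.mono fun s hs => h.continuous_q.1 s hs)).congr_deriv ?_
        rw [Fin.sum_univ_three]
        refine (Represents.of_memLp hqt.1).eq
          (((((rQ 0).add (rQ 1)).add (rQ 2)).mul hρ hρD).neg) ?_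
        filter_upwards [hmass] with x hx
        rw [Fin.sum_univ_three] at hx
        linarith
      momentum_zero := by
        refine ((rv' 0).mul hρ hρD).eq (((rP 0).neg.sub (((rG 0).mul hρ hρD).smul D.g)).add
          (((rv 1).mul hρ hρD).smul (2 * D.angVel))) ?_
        filter_upwards [hmom] with x hx
        linarith [hx.1]
      momentum_one := by
        refine ((rv' 1).mul hρ hρD).eq (((rP 1).neg.sub (((rG 1).mul hρ hρD).smul D.g)).sub
          (((rv 0).mul hρ hρD).smul (2 * D.angVel))) ?_
        filter_upwards [hmom] with x hx
        linarith [hx.2.1]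
      momentum_two := by
        refine ((rv' 2).mul hρ hρD).eq (((rP 2).neg.sub (rq.smul D.g)).sub
          (((rG 2).mul hρ hρD).smul D.g)) ?_
        filter_upwards [hmom] with x hx
        linarith [hx.2.2]
      orbit_G_zero := (hG 0).hasDerivAt_orbit (by decide)
      orbit_G_one := (hG 1).hasDerivAt_orbit (by decide)
      orbit_F_zero := hF₀.hasDerivAt_orbit (by decide)
      orbit_F_one := hF₁.hasDerivAt_orbit (by decide)
      weak_η := fun Φ Φ' hΦ => by
        rw [Fin.sum_univ_three, hF₀.inner_test hΦ, hF₁.inner_test hΦ, (hG 2).inner_test hΦ,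
          inner_add_left, inner_add_left]
        ring
      weak_v := fun Φ Φ' hΦ => by
        rw [Fin.sum_univ_three, (hQ 0).inner_test hΦ, (hQ 1).inner_test hΦ, (hQ 2).inner_test hΦ,
          Fin.sum_univ_three, inner_add_left, inner_add_left]
        ring
      support := by
        filter_upwards [rq.eq_zero, rF.eq_zero] with x h1 h2 hx using ⟨h1 hx, h2 hx⟩ }

end Solutions

/-! ### Uniqueness -/

theorem ae_eq_of_components {μ : Measure Pt} {f g : Pt → EuclideanSpace ℝ (Fin 3)}
    (h : ∀ i, (fun x => f x i) =ᵐ[μ] fun x => g x i) : f =ᵐ[μ] g := by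
  filter_upwards [ae_all_iff.2 h] with x hx
  ext i
  exact hx i

theorem extendZero_congr {s : Set Pt} (hs : MeasurableSet s) {f g : Pt → ℝ}
    (hf : MemLp f 2 (volume.restrict s)) (h : f =ᵐ[volume.restrict s] g) :
    extendZero s f = extendZero s g := by
  rw [EventuallyEq, ae_restrict_iff' hs] at h
  refine Lp.ext ?_
  filter_upwards [coeFn_extendZero hs hf,
    coeFn_extendZero hs (hf.ae_eq ((ae_restrict_iff' hs).2 h)), h] with x h1 h2 h3
  rw [h1, h2]
  by_cases hx : x ∈ s <;> simp [hx, h3]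

theorem Data.IsSolution.eq_of_pos (hD : D.Admissible) {T : EReal}
    {η₁ v₁ η₂ v₂ : ℝ → Pt → EuclideanSpace ℝ (Fin 3)} {q₁ q₂ : ℝ → Pt → ℝ}
    (h₁ : D.IsSolution T η₁ v₁ q₁) (h₂ : D.IsSolution T η₂ v₂ q₂)
    (hη₀ : η₁ 0 =ᵐ[volume.restrict D.domain] η₂ 0)
    (hv₀ : v₁ 0 =ᵐ[volume.restrict D.domain] v₂ 0)
    (hq₀ : q₁ 0 =ᵐ[volume.restrict D.domain] q₂ 0) {t : ℝ} (ht : 0 < t) (htT : (t : EReal) < T) :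
    η₁ t =ᵐ[volume.restrict D.domain] η₂ t ∧ v₁ t =ᵐ[volume.restrict D.domain] v₂ t ∧
      q₁ t =ᵐ[volume.restrict D.domain] q₂ t := by
  obtain ⟨ρ, π, c, C, hρ, hπ, hρD, hπD⟩ := hD.exists_coefficients
  have hsub : ∀ s ∈ Icc 0 t, s ∈ {s : ℝ | 0 ≤ s ∧ (s : EReal) < T} := fun s hs =>
    ⟨hs.1, (EReal.coe_le_coe_iff.2 hs.2).trans_lt htT⟩
  have hms := measurableSet_domain (D := D)
  let E : (Pt → ℝ) → L2 := extendZero D.domain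
  let η : ℝ → Fin 3 → L2 := fun s i => E (fun x => η₁ s x i) - E fun x => η₂ s x i
  let v : ℝ → Fin 3 → L2 := fun s i => E (fun x => v₁ s x i) - E fun x => v₂ s x i
  let q : ℝ → L2 := fun s => E (q₁ s) - E (q₂ s)
  have hη : ∀ i, ContinuousOn (fun s => η s i) (Icc 0 t) := fun i =>
    ((continuousOn_extendZero hms (h₁.continuous_η i)).sub
      (continuousOn_extendZero hms (h₂.continuous_η i))).mono hsub
  have hv : ∀ i, ContinuousOn (fun s => v s i) (Icc 0 t) := fun i =>
    ((continuousOn_extendZero hms (h₁.continuous_v i)).sub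
      (continuousOn_extendZero hms (h₂.continuous_v i))).mono hsub
  have hq : ContinuousOn q (Icc 0 t) :=
    ((continuousOn_extendZero hms h₁.continuous_q).sub
      (continuousOn_extendZero hms h₂.continuous_q)).mono hsub
  have h0 := hsub 0 ⟨le_rfl, ht.le⟩
  have hη0 : ∀ i, η 0 i = 0 := fun i => sub_eq_zero.2 <|
    extendZero_congr hms ((h₁.continuous_η i).1 0 h0) (hη₀.mono fun x hx => by simp only [hx])
  have hv0 : ∀ i, v 0 i = 0 := fun i => sub_eq_zero.2 <|
    extendZero_congr hms ((h₁.continuous_v i).1 0 h0) (hv₀.mono fun x hx => by simp only [hx])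
  have hq0 : q 0 = 0 := sub_eq_zero.2 <| extendZero_congr hms (h₁.continuous_q.1 0 h0) hq₀
  have hst : ∀ s ∈ Ioo 0 t, ∃ v' P Q G F₀ F₁, StateAt D hρ.mul η v q s v' P Q G F₀ F₁ ∧
      ∀ i, TranslatesOrthogonal (P i) (hπ.mul (q s)) (v s i) (Q i) := by
    intro s hs
    have hsT := (hsub s (Ioo_subset_Icc_self hs)).2
    obtain ⟨v₁', P₁, Q₁, G₁, F₀₁, F₁₁, hP₁, hQ₁, hst₁⟩ := h₁.exists_stateAt hρ hρD hs.1 hsT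
    obtain ⟨v₂', P₂, Q₂, G₂, F₀₂, F₁₂, hP₂, hQ₂, hst₂⟩ := h₂.exists_stateAt hρ hρD hs.1 hsT
    refine ⟨_, _, _, _, _, _, hst₁.sub hst₂, fun i => ?_⟩
    have hπq : ∀ {q : Pt → ℝ}, MemLp q 2 (volume.restrict D.domain) →
        MemLp (fun x => D.dp x.2 * q x) 2 (volume.restrict D.domain) →
        hπ.mul (E q) = E fun x => D.dp x.2 * q x := fun h h' =>
      ((Represents.of_memLp h).mul hπ hπD).eq (.of_memLp h') (ae_of_all _ fun _ => rfl)
    have hm₁ := h₁.continuous_q.1 s ⟨hs.1.le, hsT⟩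
    have hm₂ := h₂.continuous_q.1 s ⟨hs.1.le, hsT⟩
    have e1 : hπ.mul (q s) = E (fun x => D.dp x.2 * q₁ s x) - E fun x => D.dp x.2 * q₂ s x := by
      simp only [q, map_sub]
      rw [hπq hm₁ (hP₁ 0).memLp, hπq hm₂ (hP₂ 0).memLp]
    rw [e1]
    have hl := hD.l_pos
    have hm := hD.m_pos
    have b₁ := (h₁.jump_v s hs.1 hsT)
    have b₂ := (h₂.jump_v s hs.1 hsT)
    have top₁ := h₁.boundary_top s hs.1 hsT
    have top₂ := h₂.boundary_top s hs.1 hsT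
    have bot₁ := h₁.boundary_bottom s hs.1 hsT
    have bot₂ := h₂.boundary_bottom s hs.1 hsT
    have j₁ := h₁.jump_q s hs.1 hsT
    have j₂ := h₂.jump_q s hs.1 hsT
    -- Green's identity is bilinear in the pressure and the velocity, so for the differences it
    -- follows from the four pairings of the two solutions; this avoids forming traces of
    -- differences.
    have t₁₁ := translatesOrthogonal_partial hl hm i (V := fun i x => v₁ s x i) (hP₁ i) (hQ₁ i)
      j₁ b₁ top₁ bot₁
    have t₁₂ := translatesOrthogonal_partial hl hm i (V := fun i x => v₂ s x i) (hP₁ i) (hQ₂ i)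
      j₁ b₂ top₂ bot₂
    have t₂₁ := translatesOrthogonal_partial hl hm i (V := fun i x => v₁ s x i) (hP₂ i) (hQ₁ i)
      j₂ b₁ top₁ bot₁
    have t₂₂ := translatesOrthogonal_partial hl hm i (V := fun i x => v₂ s x i) (hP₂ i) (hQ₂ i)
      j₂ b₂ top₂ bot₂
    exact (t₁₁.sub_left t₂₁).sub_right (t₁₂.sub_left t₂₂)
  have hst' : ∀ s ∈ Ioo 0 t, ∃ v' P Q G F₀ F₁, StateAt D hρ.mul η v q s v' P Q G F₀ F₁ :=
    fun s hs => by
      obtain ⟨v', P, Q, G, F₀, F₁, h, -⟩ := hst s hs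
      exact ⟨v', P, Q, G, F₀, F₁, h⟩
  -- The weight `p'(ρ₀)/ρ₀` of `q²` in the energy is the one for which the mass equation produces
  -- exactly the pressure `p'(ρ₀) q`.
  have hK := hρ.div hπ
  have hKR : ∀ f, hK.mul (hρ.mul f) = hπ.mul f := hρ.mul_mul_eq fun z =>
    div_mul_cancel₀ _ (hρ.pos.trans_le (hρ.lower z)).ne'
  -- A common coercivity constant: `c` for `ρ₀`, `c / C` for `p'(ρ₀)/ρ₀`, and `1` for the unweighted
  -- term in `η`.
  have hc' : 0 < min (min c (c / C)) 1 := lt_min (lt_min hρ.pos hK.pos) one_pos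
  have hzero : ∀ δ₀ > 0, ∀ δ₁ > 0, (∀ i, smooth δ₀ δ₁ 0 0 (η t i) = 0) ∧
      (∀ i, smooth δ₀ δ₁ 0 0 (v t i) = 0) ∧ smooth δ₀ δ₁ 0 0 (q t) = 0 := by
    intro δ₀ hδ₀ δ₁ hδ₁
    refine eq_zero_of_evolvesAt (R := hρ.mul) (K := hK.mul) (Pi := hπ.mul)
      (S := smooth δ₀ δ₁) (g := D.g) (α := D.angVel) (κ₀ := -δ₀⁻¹) (κ₁ := -δ₁⁻¹) hc'
      (min_le_right _ _)
      (fun f => (mul_le_mul_of_nonneg_right ((min_le_left _ _).trans (min_le_left _ _))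
        (sq_nonneg _)).trans (hρ.le_inner_mul f))
      (fun f => (mul_le_mul_of_nonneg_right ((min_le_left _ _).trans (min_le_right _ _))
        (sq_nonneg _)).trans (hK.le_inner_mul f))
      hρ.inner_mul hK.inner_mul hπ.inner_mul hKR
      (fun j k f => smooth_comm δ₀ δ₁ j k _ (fun w hw f => hρ.mul_translate hw f) f)
      (fun j k f => smooth_comm δ₀ δ₁ j k _ (fun w hw f => hπ.mul_translate hw f) f)
      (fun r hr => norm_smooth_le δ₀ δ₁ hr) hη hv hq hη0 hv0 hq0 ?_ t ⟨ht.le, le_rfl⟩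
    intro s hs
    obtain ⟨v', P, Q, G, F₀, F₁, h, hgr⟩ := hst s hs
    exact ⟨v', P, Q, G, F₀, F₁,
      { deriv_η := h.deriv_η
        deriv_v := h.deriv_v
        deriv_q := h.deriv_q
        momentum_zero := h.momentum_zero
        momentum_one := h.momentum_one
        momentum_two := h.momentum_two
        vertical := add_div_eq_zero hρ hη hq hη0 hq0 hst' hs h
        smooth_G_zero := fun j k => smooth_deriv_zero hδ₀.ne' j k h.orbit_G_zero
        smooth_G_one := fun j k => smooth_deriv_one hδ₁.ne' j k h.orbit_G_one
        smooth_F_zero := fun j k => smooth_deriv_zero hδ₀.ne' j k h.orbit_F_zero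
        smooth_F_one := fun j k => smooth_deriv_one hδ₁.ne' j k h.orbit_F_one
        green := fun j k => Finset.sum_eq_zero fun i _ => (hgr i).smooth δ₀ δ₁ j k }⟩
  have htm := hsub t ⟨ht.le, le_rfl⟩
  have hfin : ∀ {f g : Pt → ℝ}, MemLp f 2 (volume.restrict D.domain) →
      MemLp g 2 (volume.restrict D.domain) → E f - E g = 0 → f =ᵐ[volume.restrict D.domain] g := by
    intro f g hf hg h
    refine Represents.ae_eq (F := E f) (.of_memLp hf) ?_
    rw [sub_eq_zero.1 h]
    exact .of_memLp hg
  refine ⟨ae_eq_of_components fun i => ?_, ae_eq_of_components fun i => ?_, ?_⟩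
  · exact hfin ((h₁.continuous_η i).1 t htm) ((h₂.continuous_η i).1 t htm)
      (eq_zero_of_smooth_eq_zero fun δ₀ hδ₀ δ₁ hδ₁ => (hzero δ₀ hδ₀ δ₁ hδ₁).1 i)
  · exact hfin ((h₁.continuous_v i).1 t htm) ((h₂.continuous_v i).1 t htm)
      (eq_zero_of_smooth_eq_zero fun δ₀ hδ₀ δ₁ hδ₁ => (hzero δ₀ hδ₀ δ₁ hδ₁).2.1 i)
  · exact hfin (h₁.continuous_q.1 t htm) (h₂.continuous_q.1 t htm)
      (eq_zero_of_smooth_eq_zero fun δ₀ hδ₀ δ₁ hδ₁ => (hzero δ₀ hδ₀ δ₁ hδ₁).2.2)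

end RotatingRT

end

theorem theorem3p1 (D : RotatingRT.Data) (hD : D.Admissible) (T : EReal)
    (η₁ v₁ η₂ v₂ : ℝ → RotatingRT.Pt → EuclideanSpace ℝ (Fin 3))
    (q₁ q₂ : ℝ → RotatingRT.Pt → ℝ)
    (h₁ : D.IsSolution T η₁ v₁ q₁) (h₂ : D.IsSolution T η₂ v₂ q₂)
    (hη₀ : η₁ 0 =ᵐ[volume.restrict D.domain] η₂ 0)
    (hv₀ : v₁ 0 =ᵐ[volume.restrict D.domain] v₂ 0)
    (hq₀ : q₁ 0 =ᵐ[volume.restrict D.domain] q₂ 0) :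
    ∀ t : ℝ, 0 ≤ t → (t : EReal) < T →
      η₁ t =ᵐ[volume.restrict D.domain] η₂ t ∧
      v₁ t =ᵐ[volume.restrict D.domain] v₂ t ∧
      q₁ t =ᵐ[volume.restrict D.domain] q₂ t := by
  intro t ht htT
  rcases ht.eq_or_lt with rfl | ht
  · exact ⟨hη₀, hv₀, hq₀⟩
  · exact h₁.eq_of_pos hD h₂ hη₀ hv₀ hq₀ ht htT
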